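/- **Setting.** Let $\mathbb F_2$ be the field with two elements, $R_{2n}$ the $2n\times 2n$ reverse diagonal matrix (ones exactly on the antidiagonal), and $\mathrm{Sp}_{2n}=\{C\in\mathbb F_2^{2n\times 2n}: C^\top R_{2n}C=R_{2n}\}$. Let $0\le\delta\le 3/4$ and let the random vector $U\in\mathbb F_2^{2n}$ describe the Pauli error of $n$ independent qubit depolarizing channels with parameter $\delta$: the pairs $(U_i,U_{2n+1-i})$, $i=1,\dots,n$, are independent, equal to $(0,0)$ with probability $1-\delta$ and to each of the other three values with probability $\delta/3$. Let $p_U$ be the law of $U$. For $n=m+k$, $C\in\mathrm{Sp}_{2n}$ and a decoder $D:\mathbb F_2^m\to\mathbb F_2^{2n}$, the probability of guessing incorrectly is $\Pr[D((CU)_1,\dots,(CU)_m)\ne U]$. For $\epsilon>0$, the optimal error-guessing rate $R(p_U,\epsilon)$ is the maximum of $k/n$ over all $0\le k\le n$ for which some pair $C,D$ with $m=n-k$ guesses incorrectly with probability at most $\epsilon$ (it is defined when there is at least one such $k$). List the $4^n$ vectors of $\mathbb F_2^{2n}$ in decreasing order of probability under $p_U$, with ties resolved arbitrarily, and let $J\in\{1,\dots,4^n\}$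 be the position of $U$ in the list. For $r=k/n$ and $m=n-k$, the converse and achievability bounds on the error probability are $$\underline{\varepsilon}(p_U,r)=\Pr[J>2^m],\qquad \overline{\varepsilon}(p_U,r)=\Pr[J>2^m]+\mathbb E\big[\mathbf 1_{J\le 2^m}(J-1)2^{-m}\big].$$ Let $B(n,p,i)=\sum_{j=0}^{i}\binom nj p^j(1-p)^{n-j}$ be the binomial CDF, extended to the piecewise linear function of a real argument whose graph on $[-1,n]$ connects $(-1,0),(0,B(n,p,0)),\dots,(n,B(n,p,n))$; for $0<p<1$ let $B^{-1}(n,p,\cdot):[0,1]\to[-1,n]$ be its inverse. Let $\Phi$ be the standard normal CDF and $h(\delta)=-\delta\log_2\delta-(1-\delta)\log_2(1-\delta)$. **Theorem.** Let $0\le\delta\le 3/4$. (1) For all $n\ge1$ and $0\le k\le n$, with $r=k/n$, $m=n-k$ and $\ell=B^{-1}\!\left(n,\tfrac34,\tfrac{2^m}{4^n}\right)$, $$\underline{\varepsilon}(p_U,r)=B(n,1-\delta,n-1-\ell)$$ and $$\overline{\varepsilon}(p_U,r)=\Big(1+\frac1{2^{m+1}}\Big)B(n,1-\delta,n-1-\ell)-\frac1{2^{m+1}}+2^{m-1}(1-\delta)^n\Big(\frac{\delta}{3-3\delta}\Big)^{\lfloor\ell\rfloor+1}+\frac{(16-16\delta)^n}{2^{m+1}}\Big(\frac{3-4\delta}{3-3\delta}\Big)\sum_{i=0}^{\lfloor\ell\rfloor}\Big(\frac{\delta}{3-3\delta}\Big)^i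 B\big(n,\tfrac34,i\big)^2 .$$ (2) Let $\delta>0$ and $0<\epsilon<1$ be fixed. If $1-h(\delta)-\delta\log_2 3>0$, then $R(p_U,\epsilon)$ is defined for all sufficiently large $n$. Moreover, there are constants $K$ and $N$, depending only on $\delta$ and $\epsilon$, such that for every $n\ge N$ for which $R(p_U,\epsilon)$ is defined (whatever the sign of $1-h(\delta)-\delta\log_2 3$), $$\left|R(p_U,\epsilon)-\left(1-h(\delta)-\delta\log_2 3-\sqrt{\frac{\delta(1-\delta)}{n}}\,\Phi^{-1}(\epsilon)\log_2\frac{\delta}{3(1-\delta)}+\frac{\log_2 n}{2n}\right)\right|\le\frac Kn .$$ -/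

import Mathlib

open scoped Matrix
open Finset

noncomputable section

namespace PauliGuess

/-- Column vectors in `𝔽₂^{2n}`, the values of a Pauli error on `n` qubits. -/
abbrev PVec (n : ℕ) : Type := Fin (2 * n) → ZMod 2

/-- The `N × N` reverse diagonal matrix over `𝔽₂` (ones exactly on the antidiagonal). -/
def revDiag (N : ℕ) : Matrix (Fin N) (Fin N) (ZMod 2) :=
  Matrix.of fun i j => if j = i.rev then 1 else 0

/-- The symplectic group: the `2n × 2n` matrices `C` over `𝔽₂` with `Cᵀ R C = R`,
where `R` is the reverse diagonal matrix. -/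
def symplecticSet (n : ℕ) : Set (Matrix (Fin (2 * n)) (Fin (2 * n)) (ZMod 2)) :=
  {C | Cᵀ * revDiag (2 * n) * C = revDiag (2 * n)}

/-- The syndrome of `u`: the first `m` coordinates of `C u`. -/
def syndrome {n m : ℕ} (hm : m ≤ n) (C : Matrix (Fin (2 * n)) (Fin (2 * n)) (ZMod 2))
    (u : PVec n) : Fin m → ZMod 2 :=
  fun i => (C *ᵥ u) (Fin.castLE (hm.trans (Nat.le_mul_of_pos_left n two_pos)) i)

/-- For a random vector `U` with probability mass function `p`, the probability that the decoder
`D`, given the `m`-bit syndrome of `U` under `C`, does not output `U`. -/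
def guessErrorProb {n m : ℕ} (hm : m ≤ n) (p : PVec n → ℝ)
    (C : Matrix (Fin (2 * n)) (Fin (2 * n)) (ZMod 2)) (D : (Fin m → ZMod 2) → PVec n) : ℝ :=
  ∑ u with D (syndrome hm C u) ≠ u, p u

/-- The rates `k / n` (with `n = m + k`) for which some pair `C, D` using `m` syndrome bits guesses
`U` incorrectly with probability at most `ε`. -/
def guessRates {n : ℕ} (p : PVec n → ℝ) (ε : ℝ) : Set ℝ :=
  {r | ∃ (m k : ℕ) (h : m + k = n), r = (k : ℝ) / n ∧
    ∃ C ∈ symplecticSet n, ∃ D : (Fin m → ZMod 2) → PVec n,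
      guessErrorProb (h ▸ Nat.le_add_right m k) p C D ≤ ε}

/-- `R` is the optimal error-guessing rate: the maximum of the rates above. -/
def IsErrorGuessRate {n : ℕ} (p : PVec n → ℝ) (ε R : ℝ) : Prop :=
  IsGreatest (guessRates p ε) R

/-- `o` lists the `2^{2n}` vectors in decreasing order of probability (ties in any way);
position `j` of the list, counted from `1`, is `o ⟨j - 1, _⟩`. -/
def IsSortedOrder {n : ℕ} (p : PVec n → ℝ) (o : Fin (2 ^ (2 * n)) ≃ PVec n) : Prop :=
  Antitone fun j => p (o j)

/-- The position, counted from `1`, of `u` in the list `o`; the random variable `J` is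
`position o U`. -/
def position {n : ℕ} (o : Fin (2 ^ (2 * n)) ≃ PVec n) (u : PVec n) : ℕ :=
  (o.symm u : ℕ) + 1

/-- The converse bound on the error probability with `m` syndrome bits, `P(J > 2^m)`. -/
def errorConverse {n : ℕ} (p : PVec n → ℝ) (o : Fin (2 ^ (2 * n)) ≃ PVec n) (m : ℕ) : ℝ :=
  ∑ u with 2 ^ m < position o u, p u

/-- The achievability bound on the error probability with `m` syndrome bits,
`P(J > 2^m) + E[1_{J ≤ 2^m} (J - 1) 2^{-m}]`. -/
def errorAchievability {n : ℕ} (p : PVec n → ℝ) (o : Fin (2 ^ (2 * n)) ≃ PVec n) (m : ℕ) : ℝ :=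
  (∑ u with 2 ^ m < position o u, p u)
    + ∑ u with position o u ≤ 2 ^ m, p u * (((position o u : ℝ) - 1) / 2 ^ m)

/-- The coordinate of a vector in `𝔽₂^{2n}` that holds the exponent of the Pauli `X` on qubit `i`.
The exponent of `Z` on qubit `i` is at the mirror image `(xPos i).rev`. -/
def xPos {n : ℕ} (i : Fin n) : Fin (2 * n) :=
  Fin.castLE (Nat.le_mul_of_pos_left n two_pos) i

/-- The law of the Pauli error `X^a Z^b` of one depolarizing channel
`ρ ↦ (1 - δ) ρ + (δ / 3) (X ρ X + Z ρ Z + X Z ρ Z X)`. -/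
def depolarizingLawOne (δ : ℝ) (a b : ZMod 2) : ℝ :=
  if a = 0 ∧ b = 0 then 1 - δ else δ / 3

/-- The law of the Pauli error of `n` independent depolarizing channels. -/
def depolarizingLaw (n : ℕ) (δ : ℝ) (u : PVec n) : ℝ :=
  ∏ i : Fin n, depolarizingLawOne δ (u (xPos i)) (u (xPos i).rev)

/-- The number of qubits on which the Pauli error `u` acts nontrivially. -/
def weight {n : ℕ} (u : PVec n) : ℕ :=
  #{i : Fin n | ¬ (u (xPos i) = 0 ∧ u (xPos i).rev = 0)}

theorem depolarizingLaw_eq (n : ℕ) (δ : ℝ) (u : PVec n) :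
    depolarizingLaw n δ u = (δ / 3) ^ weight u * (1 - δ) ^ (n - weight u) := by
  unfold depolarizingLaw depolarizingLawOne
  rw [Finset.prod_ite, Finset.prod_const, Finset.prod_const, mul_comm]
  have h := Finset.card_filter_add_card_filter_not (s := (Finset.univ : Finset (Fin n)))
    (fun i : Fin n => u (xPos i) = 0 ∧ u (xPos i).rev = 0)
  rw [Finset.card_univ, Fintype.card_fin] at h
  unfold weight
  congr 2
  omega

/-- The `Binomial(N, p)` cumulative distribution function at an integer `i` (it is `0` for `i < 0`
and `1` for `i ≥ N`). -/
def binCDFInt (N : ℕ) (p : ℝ) (i : ℤ) : ℝ :=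
  ∑ j ∈ Finset.range (i + 1).toNat, (N.choose j : ℝ) * p ^ j * (1 - p) ^ (N - j)

/-- The piecewise linear interpolation of the binomial CDF through its values at the integers;
on `[-1, N]` it runs through `(-1, 0), (0, F 0), …, (N, F N)`. -/
def binCDF (N : ℕ) (p x : ℝ) : ℝ :=
  binCDFInt N p ⌊x⌋ + Int.fract x * (binCDFInt N p (⌊x⌋ + 1) - binCDFInt N p ⌊x⌋)

/-- The inverse of the bijection `binCDF N p : [-1, N] → [0, 1]` (for `0 < p < 1`). -/
def binCDFInv (N : ℕ) (p : ℝ) : ℝ → ℝ :=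
  Function.invFunOn (binCDF N p) (Set.Icc (-1) (N : ℝ))

/-- The inverse, on `(0, 1)`, of the standard normal cumulative distribution function. -/
def normalCDFInv : ℝ → ℝ :=
  Function.invFun (ProbabilityTheory.cdf (ProbabilityTheory.gaussianReal 0 1))

/-- The binary entropy in bits. -/
def binEntropyTwo (δ : ℝ) : ℝ := -δ * Real.logb 2 δ - (1 - δ) * Real.logb 2 (1 - δ)

/-- The hashing bound `1 - h(δ) - δ log₂ 3` of the depolarizing channel. -/
def hashingBound (δ : ℝ) : ℝ := 1 - binEntropyTwo δ - δ * Real.logb 2 3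

end PauliGuess

end

/-! The law of the Pauli error depends only on its weight, is nonincreasing in the weight because `δ
≤ 3/4`, and there are `n.choose w * 3 ^ w` errors of weight `w`. A sorted list is therefore a
sequence of blocks of constant probability, one per weight (`IsSortedOrder.apply_eq`). The block
ends are `4 ^ n` times the values of the Binomial(n, 3/4) distribution function, so `ℓ` records the
block in which position `2 ^ m` falls and the fraction of that block used up; linear interpolation
is exact because a block is uniform. The weight itself is Binomial(n, δ), which gives the converse
bound after reflection. For the achievability bound, `2 J - 1 = J ^ 2 - (J - 1) ^ 2` telescopes over
blocks, and summation by parts produces the squares.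

The expansion of the rate does not use these formulas. It compares two estimates of the number of
syndrome bits, which agree up to a constant. Stein's method gives a Berry–Esseen bound
(`berryEsseen_binomial`), hence the quantiles of the weight up to a bounded error, with room for a
probability `1 / s`, where `s` of order `√n` is the standard deviation (`exists_binomial_quantile`).
Converse: at most `2 ^ m` errors are guessed correctly, so `2 ^ m` times the probability of an error
beyond the quantile must cover at least `1 / s` (`one_le_guessErrorProb_add`). Achievability: for a
uniform symplectic matrix and a fixed nonzero vector, transitivity bounds the probability of a zero
syndrome by `2 ^ (-m)`. A union bound for minimum weight decoding then leaves the expected number of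
competitors (`exists_guessErrorProb_le`). The estimate of each binomial probability by `1 / s`
enters that number twice, against an allowance of `1 / s` (`sum_card_weight_le`). Either way a net
`log₂ s` is saved, which is the term `log₂ n / 2`. -/

noncomputable section

namespace PauliGuess

/-! ### Binomial expectations and Stein's identity -/

/-- The expectation of `g S` for a `Binomial(n, p)` random variable `S`. -/
def binE (n : ℕ) (p : ℝ) (g : ℕ → ℝ) : ℝ :=
  ∑ k ∈ range (n + 1), (n.choose k : ℝ) * p ^ k * (1 - p) ^ (n - k) * g k

theorem binE_add (n : ℕ) (p : ℝ) (g h : ℕ → ℝ) :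
    binE n p (fun k => g k + h k) = binE n p g + binE n p h := by
  simp only [binE, ← sum_add_distrib, mul_add]

theorem binE_sub (n : ℕ) (p : ℝ) (g h : ℕ → ℝ) :
    binE n p (fun k => g k - h k) = binE n p g - binE n p h := by
  simp only [binE, ← sum_sub_distrib, mul_sub]

theorem binE_const_mul (n : ℕ) (p c : ℝ) (g : ℕ → ℝ) :
    binE n p (fun k => c * g k) = c * binE n p g := by
  simp only [binE, mul_sum]
  exact sum_congr rfl fun k _ => by ring

theorem binE_one (n : ℕ) (p : ℝ) : binE n p (fun _ => 1) = 1 := by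
  have h := add_pow p (1 - p) n
  simp only [add_sub_cancel, one_pow] at h
  refine Eq.trans (sum_congr rfl fun k _ => ?_) h.symm
  ring

theorem binE_const (n : ℕ) (p c : ℝ) : binE n p (fun _ => c) = c := by
  simpa [binE_one] using binE_const_mul n p c (fun _ => 1)

theorem binE_mono {n : ℕ} {p : ℝ} (h0 : 0 ≤ p) (h1 : p ≤ 1) {g h : ℕ → ℝ}
    (hgh : ∀ k ≤ n, g k ≤ h k) : binE n p g ≤ binE n p h := by
  refine sum_le_sum fun k hk => mul_le_mul_of_nonneg_left (hgh k (by simpa [Nat.lt_succ_iff] using hk)) ?_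
  have : 0 ≤ 1 - p := by linarith
  positivity

theorem abs_binE_le {n : ℕ} {p : ℝ} (h0 : 0 ≤ p) (h1 : p ≤ 1) {g h : ℕ → ℝ}
    (hgh : ∀ k ≤ n, |g k| ≤ h k) : |binE n p g| ≤ binE n p h := by
  rw [abs_le]
  constructor
  · have := binE_mono h0 h1 (n := n) (g := fun k => (-1) * h k) (h := g)
      fun k hk => by linarith [neg_abs_le (g k), hgh k hk]
    rw [binE_const_mul] at this
    linarith
  · exact binE_mono h0 h1 fun k hk => (le_abs_self _).trans (hgh k hk)

/-- Condition on the outcome of one of the `n + 1` trials. -/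
theorem binE_succ (n : ℕ) (p : ℝ) (g : ℕ → ℝ) :
    binE (n + 1) p g = p * binE n p (fun k => g (k + 1)) + (1 - p) * binE n p g := by
  have h1 : (1 - p) * binE n p g = (1 - p) ^ (n + 1) * g 0 +
      ∑ k ∈ range (n + 1), (n.choose (k + 1) : ℝ) * p ^ (k + 1) * (1 - p) ^ (n - k) * g (k + 1) := by
    rw [sum_range_succ, Nat.choose_succ_self, binE, sum_range_succ', mul_add, mul_sum]
    simp only [Nat.choose_zero_right, Nat.cast_one, pow_zero, Nat.sub_zero, Nat.cast_zero, zero_mul,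
      add_zero]
    rw [add_comm]
    congr 1
    · ring
    · refine sum_congr rfl fun k hk => ?_
      have : n - k = n - (k + 1) + 1 := by have := mem_range.1 hk; omega
      rw [this]
      ring
  rw [h1, binE, binE, sum_range_succ', mul_sum]
  simp only [Nat.choose_zero_right, Nat.cast_one, pow_zero, Nat.sub_zero, one_mul]
  rw [add_comm, add_left_comm, ← sum_add_distrib]
  congr 1
  refine sum_congr rfl fun k _ => ?_
  rw [Nat.choose_succ_succ, Nat.add_sub_add_right]
  push_cast
  ring

theorem binE_id_mul (n : ℕ) (p : ℝ) (g : ℕ → ℝ) :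
    binE (n + 1) p (fun k => k * g k) = (n + 1) * p * binE n p (fun k => g (k + 1)) := by
  rw [binE, binE, sum_range_succ', mul_sum]
  simp only [Nat.cast_zero, zero_mul, mul_zero, add_zero]
  refine sum_congr rfl fun k _ => ?_
  have h : ((n + 1).choose (k + 1) : ℝ) * (k + 1) = (n + 1) * n.choose k := by
    exact_mod_cast (Nat.add_one_mul_choose_eq n k).symm
  rw [Nat.add_sub_add_right]
  push_cast
  linear_combination p ^ (k + 1) * (1 - p) ^ (n - k) * g (k + 1) * h

/-- Stein's identity for the binomial distribution. -/
theorem binE_stein (n : ℕ) (p : ℝ) (g : ℕ → ℝ) :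
    binE (n + 1) p (fun k => (k - (n + 1) * p) * g k) =
      (n + 1) * p * (1 - p) * binE n p (fun k => g (k + 1) - g k) := by
  simp only [sub_mul, binE_sub, binE_const_mul, binE_id_mul]
  rw [binE_succ]
  ring

theorem binE_variance (n : ℕ) (p : ℝ) :
    binE (n + 1) p (fun k => (k - (n + 1) * p) ^ 2) = (n + 1) * p * (1 - p) := by
  have := binE_stein n p (fun k => k - (n + 1) * p)
  simpa [pow_two, binE_one] using this

/-- The standard deviation of the `Binomial(n, p)` distribution. -/
def binSD (n : ℕ) (p : ℝ) : ℝ := Real.sqrt (n * p * (1 - p))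

theorem binSD_sq {p : ℝ} (n : ℕ) (h0 : 0 ≤ p) (h1 : p ≤ 1) :
    binSD n p ^ 2 = n * p * (1 - p) := by
  have : 0 ≤ 1 - p := by linarith
  exact Real.sq_sqrt (by positivity)

theorem binSD_pos {p : ℝ} {n : ℕ} (hn : 0 < n) (h0 : 0 < p) (h1 : p < 1) : 0 < binSD n p := by
  have : 0 < 1 - p := by linarith
  exact Real.sqrt_pos.2 (by positivity)

theorem binE_abs_sub_le {n : ℕ} {p : ℝ} (h0 : 0 < p) (h1 : p < 1) :
    binE (n + 1) p (fun k => |(k : ℝ) - (n + 1) * p|) ≤ binSD (n + 1) p := by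
  set s := binSD (n + 1) p
  have hs : 0 < s := binSD_pos n.succ_pos h0 h1
  have h2 : s ^ 2 = (n + 1) * p * (1 - p) := by
    simpa using binSD_sq (n + 1) h0.le h1.le
  have key := binE_mono h0.le h1.le (n := n + 1) (g := fun k => 2 * s * |(k : ℝ) - (n + 1) * p|)
    (h := fun k => ((k : ℝ) - (n + 1) * p) ^ 2 + s ^ 2) fun k _ => by
      nlinarith [sq_nonneg (|(k : ℝ) - (n + 1) * p| - s), sq_abs ((k : ℝ) - (n + 1) * p)]
  rw [binE_add, binE_variance, binE_const, binE_const_mul, ← h2] at key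
  nlinarith

theorem binE_indicator (n : ℕ) (p : ℝ) (i : ℕ) :
    binE n p (fun k => if k = i then 1 else 0) = (n.choose i : ℝ) * p ^ i * (1 - p) ^ (n - i) := by
  simp only [binE, mul_ite, mul_one, mul_zero, sum_ite_eq', mem_range]
  split_ifs with h
  · rfl
  · rw [Nat.choose_eq_zero_of_lt (by omega)]
    simp

/-- Stein's identity for a step function: the difference of the step is the indicator of a point,
and the other side is at most the mean absolute deviation, hence at most the standard deviation. -/
theorem binE_indicator_le {n : ℕ} {p : ℝ} (h0 : 0 < p) (h1 : p < 1) (i : ℕ) :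
    binE n p (fun k => if k = i then 1 else 0) ≤ 1 / binSD (n + 1) p := by
  have hs : 0 < binSD (n + 1) p := binSD_pos n.succ_pos h0 h1
  have h2 : binSD (n + 1) p ^ 2 = (n + 1) * p * (1 - p) := by
    simpa using binSD_sq (n + 1) h0.le h1.le
  have h := binE_stein n p (fun k => if i < k then 1 else 0)
  have hg : (fun k : ℕ => (if i < k + 1 then (1 : ℝ) else 0) - if i < k then 1 else 0) =
      fun k => if k = i then 1 else 0 := by
    funext k
    rcases lt_trichotomy i k with h | h | h
    · simp [h, h.ne', h.trans (Nat.lt_succ_self k)]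
    · simp [h]
    · simp [h.ne, show ¬ i < k + 1 by omega, show ¬ i < k by omega]
  rw [hg, ← h2] at h
  have hle : binE (n + 1) p (fun k => ((k : ℝ) - (n + 1) * p) * if i < k then 1 else 0) ≤
      binSD (n + 1) p := by
    refine (binE_mono h0.le h1.le fun k _ => ?_).trans (binE_abs_sub_le h0 h1)
    split_ifs
    · simpa using le_abs_self ((k : ℝ) - (n + 1) * p)
    · simp
  rw [le_div_iff₀ hs]
  nlinarith

/-- A probability of a binomial variable lying in a half-open interval of length one. -/
theorem binE_interval_le {n : ℕ} {p : ℝ} (h0 : 0 < p) (h1 : p < 1) (t : ℝ) :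
    binE n p (fun k => if (k : ℝ) ≤ t ∧ t < k + 1 then 1 else 0) ≤ 1 / binSD (n + 1) p := by
  refine (binE_mono h0.le h1.le fun k _ => ?_).trans (binE_indicator_le h0 h1 ⌊t⌋₊)
  by_cases h : (k : ℝ) ≤ t ∧ t < k + 1
  · have : k = ⌊t⌋₊ := ((Nat.floor_eq_iff ((Nat.cast_nonneg k).trans h.1)).2 h).symm
    simp [h, ← this]
  · simp only [h, if_false]
    split_ifs <;> norm_num

end PauliGuess

/-! ### The standard normal distribution -/

namespace PauliGuess

open ProbabilityTheory MeasureTheory Filter Topology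

/-- The standard normal cumulative distribution function. -/
def normalCDF (x : ℝ) : ℝ := cdf (gaussianReal 0 1) x

/-- The standard normal density. -/
def normalPDF (x : ℝ) : ℝ := gaussianPDFReal 0 1 x

theorem normalPDF_pos (x : ℝ) : 0 < normalPDF x := gaussianPDFReal_pos 0 1 x one_ne_zero

theorem normalPDF_eq (x : ℝ) :
    normalPDF x = (Real.sqrt (2 * Real.pi))⁻¹ * Real.exp (-x ^ 2 / 2) := by
  simp [normalPDF, gaussianPDFReal]

theorem normalPDF_le {x y : ℝ} (h : |x| ≤ |y|) : normalPDF y ≤ normalPDF x := by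
  rw [normalPDF_eq, normalPDF_eq]
  have := sq_le_sq.2 h
  gcongr

theorem normalPDF_neg (x : ℝ) : normalPDF (-x) = normalPDF x := by simp [normalPDF_eq]

theorem hasDerivAt_normalPDF (x : ℝ) : HasDerivAt normalPDF (-(x * normalPDF x)) x := by
  have h : HasDerivAt (fun y : ℝ => (Real.sqrt (2 * Real.pi))⁻¹ * Real.exp (-y ^ 2 / 2))
      ((Real.sqrt (2 * Real.pi))⁻¹ * (Real.exp (-x ^ 2 / 2) * (-(2 * x) / 2))) x := by
    refine HasDerivAt.const_mul _ (HasDerivAt.exp ?_)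
    simpa using ((hasDerivAt_pow 2 x).neg).div_const 2
  refine (h.congr_of_eventuallyEq (Eventually.of_forall normalPDF_eq)).congr_deriv ?_
  rw [normalPDF_eq]
  ring

theorem normalPDF_continuous : Continuous normalPDF :=
  continuous_iff_continuousAt.2 fun x => (hasDerivAt_normalPDF x).continuousAt

theorem normalCDF_nonneg (x : ℝ) : 0 ≤ normalCDF x := cdf_nonneg _ x

theorem normalCDF_le_one (x : ℝ) : normalCDF x ≤ 1 := cdf_le_one _ x

theorem normalCDF_mono : Monotone normalCDF := monotone_cdf _

theorem normalCDF_eq_integral (x : ℝ) : normalCDF x = ∫ y in Set.Iic x, normalPDF y := by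
  rw [normalCDF, cdf_eq_real, measureReal_def,
    gaussianReal_apply_eq_integral 0 one_ne_zero, ENNReal.toReal_ofReal]
  · rfl
  · exact integral_nonneg fun y => (normalPDF_pos y).le

theorem normalCDF_sub (a b : ℝ) : normalCDF b - normalCDF a = ∫ y in a..b, normalPDF y := by
  rw [normalCDF_eq_integral, normalCDF_eq_integral]
  exact intervalIntegral.integral_Iic_sub_Iic (integrable_gaussianPDFReal 0 1).integrableOn
    (integrable_gaussianPDFReal 0 1).integrableOn

theorem hasDerivAt_normalCDF (x : ℝ) : HasDerivAt normalCDF (normalPDF x) x := by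
  have h := (intervalIntegral.integral_hasDerivAt_right (a := 0) (b := x)
    (normalPDF_continuous.intervalIntegrable 0 x)
    (normalPDF_continuous.stronglyMeasurableAtFilter _ _)
    normalPDF_continuous.continuousAt).add_const (normalCDF 0)
  refine h.congr_of_eventuallyEq (Eventually.of_forall fun y => ?_)
  simp only [← normalCDF_sub, sub_add_cancel]

theorem normalCDF_continuous : Continuous normalCDF :=
  continuous_iff_continuousAt.2 fun x => (hasDerivAt_normalCDF x).continuousAt

theorem normalCDF_neg (x : ℝ) : normalCDF (-x) = 1 - normalCDF x := by
  have h := integral_comp_neg_Iic x normalPDF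
  simp only [normalPDF_neg] at h
  have h1 : (∫ y in Set.Iic (-x), normalPDF y) + ∫ y in Set.Ioi (-x), normalPDF y = 1 := by
    rw [← integral_gaussianPDFReal_eq_one 0 (one_ne_zero (α := NNReal)), ← Set.compl_Iic]
    exact integral_add_compl measurableSet_Iic (integrable_gaussianPDFReal 0 1)
  rw [normalCDF_eq_integral, normalCDF_eq_integral, h]
  linarith

theorem normalCDF_surj {y : ℝ} (h0 : 0 < y) (h1 : y < 1) : ∃ x, normalCDF x = y := by
  have hbot : Tendsto normalCDF atBot (𝓝 0) := tendsto_cdf_atBot _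
  have htop : Tendsto normalCDF atTop (𝓝 1) := tendsto_cdf_atTop _
  obtain ⟨a, ha⟩ := (hbot.eventually_lt_const h0).exists
  obtain ⟨b, hb⟩ := (htop.eventually_const_lt h1).exists
  obtain ⟨x, hx⟩ := mem_range_of_exists_le_of_exists_ge normalCDF_continuous ⟨a, ha.le⟩ ⟨b, hb.le⟩
  exact ⟨x, hx⟩

theorem normalCDF_normalCDFInv {y : ℝ} (h0 : 0 < y) (h1 : y < 1) :
    normalCDF (normalCDFInv y) = y :=
  Function.invFun_eq (f := cdf (gaussianReal 0 1)) (normalCDF_surj h0 h1)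

/-- The Mills ratio bound. -/
theorem mul_one_sub_normalCDF_le (w : ℝ) : w * (1 - normalCDF w) ≤ normalPDF w := by
  -- The derivative is `(w - x) * normalPDF x`, and the limit at infinity is nonnegative.
  have hanti : AntitoneOn (fun x => normalPDF x - w * (1 - normalCDF x)) (Set.Ici w) := by
    have hd : ∀ x, HasDerivAt (fun x => normalPDF x - w * (1 - normalCDF x))
        (-(x * normalPDF x) - w * (-normalPDF x)) x := fun x =>
      (hasDerivAt_normalPDF x).sub (((hasDerivAt_normalCDF x).const_sub 1).const_mul w)
    refine antitoneOn_of_deriv_nonpos (convex_Ici w)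
      (fun x _ => (hd x).continuousAt.continuousWithinAt)
      (fun x _ => (hd x).differentiableAt.differentiableWithinAt) fun x hx => ?_
    rw [interior_Ici] at hx
    rw [(hd x).deriv]
    nlinarith [normalPDF_pos x, Set.mem_Ioi.1 hx]
  have hlim : Tendsto (fun x => -(w * (1 - normalCDF x))) atTop (𝓝 (-(w * (1 - 1)))) :=
    ((tendsto_const_nhds.sub (tendsto_cdf_atTop (gaussianReal 0 1))).const_mul w).neg
  have hge := le_of_tendsto hlim (b := normalPDF w - w * (1 - normalCDF w)) <| by
    filter_upwards [eventually_ge_atTop w] with x hx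
    have := hanti Set.self_mem_Ici (Set.mem_Ici.2 hx) hx
    simp only at this
    linarith [normalPDF_pos x]
  linarith

/-! ### The solution of Stein's equation -/

/-- A bound on the solution of Stein's equation. -/
def steinBound : ℝ := 1 + 1 / normalPDF 1

theorem one_le_steinBound : 1 ≤ steinBound := by
  have := normalPDF_pos 1
  unfold steinBound
  have : 0 < 1 / normalPDF 1 := by positivity
  linarith

/-- The Mills bound works for `w ≥ 1`; below `1` the density is at least `normalPDF 1`. -/
theorem one_sub_normalCDF_div_le {w : ℝ} (hw : 0 ≤ w) :
    (1 - normalCDF w) / normalPDF w ≤ steinBound := by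
  have h1 := normalPDF_pos 1
  have h2 : 0 < 1 / normalPDF 1 := by positivity
  unfold steinBound
  rcases le_total 1 w with h | h
  · have := mul_one_sub_normalCDF_le w
    have : (1 - normalCDF w) / normalPDF w ≤ 1 := by
      rw [div_le_one (normalPDF_pos w)]
      nlinarith [normalCDF_le_one w]
    linarith
  · have h3 : normalPDF 1 ≤ normalPDF w := normalPDF_le (by rwa [abs_of_nonneg hw, abs_one])
    have : (1 - normalCDF w) / normalPDF w ≤ 1 / normalPDF 1 :=
      div_le_div₀ zero_le_one (by linarith [normalCDF_nonneg w]) h1 h3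
    linarith

/-- The solution `f` of Stein's equation `f' w = w f w + 1_{w ≤ z} - Φ z`. -/
def steinSol (z w : ℝ) : ℝ := normalCDF (min w z) * (1 - normalCDF (max w z)) / normalPDF w

theorem steinSol_nonneg (z w : ℝ) : 0 ≤ steinSol z w :=
  div_nonneg (mul_nonneg (normalCDF_nonneg _) (sub_nonneg.2 (normalCDF_le_one _)))
    (normalPDF_pos w).le

theorem steinSol_le (z w : ℝ) : steinSol z w ≤ (1 - normalCDF |w|) / normalPDF |w| := by
  unfold steinSol
  rcases le_total 0 w with hw | hw
  · rw [abs_of_nonneg hw]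
    refine div_le_div_of_nonneg_right ?_ (normalPDF_pos w).le
    have := normalCDF_mono (le_max_left w z)
    nlinarith [normalCDF_le_one (min w z), normalCDF_nonneg (min w z),
      normalCDF_le_one (max w z)]
  · rw [abs_of_nonpos hw, normalPDF_neg, normalCDF_neg, sub_sub_cancel]
    refine div_le_div_of_nonneg_right ?_ (normalPDF_pos w).le
    have := normalCDF_mono (min_le_left w z)
    nlinarith [normalCDF_nonneg (max w z), normalCDF_nonneg (min w z),
      normalCDF_le_one (max w z)]

theorem abs_steinSol_le (z w : ℝ) : |steinSol z w| ≤ steinBound := by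
  rw [abs_of_nonneg (steinSol_nonneg z w)]
  exact (steinSol_le z w).trans (one_sub_normalCDF_div_le (abs_nonneg w))

theorem abs_mul_steinSol_le (z w : ℝ) : |w * steinSol z w| ≤ 1 := by
  rw [abs_mul, abs_of_nonneg (steinSol_nonneg z w)]
  calc |w| * steinSol z w ≤ |w| * ((1 - normalCDF |w|) / normalPDF |w|) :=
        mul_le_mul_of_nonneg_left (steinSol_le z w) (abs_nonneg w)
    _ = |w| * (1 - normalCDF |w|) / normalPDF |w| := by rw [mul_div_assoc]
    _ ≤ 1 := by
        rw [div_le_one (normalPDF_pos _)]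
        exact mul_one_sub_normalCDF_le |w|

theorem steinSol_continuous (z : ℝ) : Continuous (steinSol z) := by
  have h1 := normalCDF_continuous
  have h2 := normalPDF_continuous
  exact ((h1.comp (continuous_id.min continuous_const)).mul
    (continuous_const.sub (h1.comp (continuous_id.max continuous_const)))).div h2
      fun w => (normalPDF_pos w).ne'

theorem hasDerivAt_steinSol_of_lt {z w : ℝ} (h : w < z) :
    HasDerivAt (steinSol z) (w * steinSol z w + 1 - normalCDF z) w := by
  have hp := (normalPDF_pos w).ne'
  have hd := ((hasDerivAt_normalCDF w).mul_const (1 - normalCDF z)).div (hasDerivAt_normalPDF w) hp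
  have he : steinSol z =ᶠ[𝓝 w] fun y => normalCDF y * (1 - normalCDF z) / normalPDF y := by
    filter_upwards [Iio_mem_nhds h] with y hy
    rw [steinSol, min_eq_left (le_of_lt hy), max_eq_right (le_of_lt hy)]
  refine (hd.congr_of_eventuallyEq he).congr_deriv ?_
  rw [he.eq_of_nhds]
  field_simp
  ring

theorem hasDerivAt_steinSol_of_gt {z w : ℝ} (h : z < w) :
    HasDerivAt (steinSol z) (w * steinSol z w - normalCDF z) w := by
  have hp := (normalPDF_pos w).ne'
  have hd := (((hasDerivAt_normalCDF w).const_sub 1).const_mul (normalCDF z)).div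
    (hasDerivAt_normalPDF w) hp
  have he : steinSol z =ᶠ[𝓝 w] fun y => normalCDF z * (1 - normalCDF y) / normalPDF y := by
    filter_upwards [Ioi_mem_nhds h] with y hy
    rw [steinSol, min_eq_right (le_of_lt hy), max_eq_left (le_of_lt hy)]
  refine (hd.congr_of_eventuallyEq he).congr_deriv ?_
  rw [he.eq_of_nhds]
  field_simp
  ring

/-- The derivative jumps only at `z`, so the mean value theorem applies to intervals without `z` in
the interior. The case `a = z` is left out because the indicator at `a` would then have the wrong
value. -/
theorem steinSol_mean_value {z a b : ℝ} (hab : a < b) (h : z < a ∨ b ≤ z) :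
    ∃ c ∈ Set.Ioo a b, steinSol z b - steinSol z a =
      (b - a) * (c * steinSol z c + (if a ≤ z then 1 else 0) - normalCDF z) := by
  obtain ⟨c, hc, hc'⟩ := exists_hasDerivAt_eq_slope (steinSol z)
    (fun c => c * steinSol z c + (if a ≤ z then 1 else 0) - normalCDF z) hab
    (steinSol_continuous z).continuousOn fun c hc => by
      rcases h with h | h
      · simpa [not_le.2 h] using hasDerivAt_steinSol_of_gt (h.trans hc.1)
      · simpa [(hab.le.trans h)] using hasDerivAt_steinSol_of_lt (hc.2.trans_le h)
  refine ⟨c, hc, ?_⟩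
  rw [hc']
  field_simp [(sub_pos.2 hab).ne']

theorem abs_ite_sub_normalCDF_le (P : Prop) [Decidable P] (z : ℝ) :
    |(if P then 1 else 0) - normalCDF z| ≤ 1 := by
  have := normalCDF_nonneg z
  have := normalCDF_le_one z
  rw [abs_le]
  split_ifs <;> constructor <;> linarith

/-- Away from `z` the derivative is at most `1 + 1` in absolute value. An interval containing `z` is
cut there, and the piece starting at `z` is reached as a limit. -/
theorem steinSol_lipschitz {z a b : ℝ} (hab : a ≤ b) :
    |steinSol z b - steinSol z a| ≤ 2 * (b - a) := by
  have key : ∀ {a b : ℝ}, a < b → (z < a ∨ b ≤ z) →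
      |steinSol z b - steinSol z a| ≤ 2 * (b - a) := fun {a b} hab h => by
    obtain ⟨c, -, hc⟩ := steinSol_mean_value hab h
    have h1 := abs_mul_steinSol_le z c
    have h2 := abs_ite_sub_normalCDF_le (a ≤ z) z
    rw [hc, abs_mul, abs_of_pos (sub_pos.2 hab), add_sub_assoc, mul_comm]
    refine mul_le_mul_of_nonneg_right ?_ (sub_pos.2 hab).le
    linarith [abs_add_le (c * steinSol z c) ((if a ≤ z then 1 else 0) - normalCDF z)]
  have hgt : ∀ {b : ℝ}, z ≤ b → |steinSol z b - steinSol z z| ≤ 2 * (b - z) := fun {b} hb => by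
    have hl : Tendsto (fun a => |steinSol z b - steinSol z a|) (𝓝[>] z)
        (𝓝 |steinSol z b - steinSol z z|) :=
      ((continuous_const.sub (steinSol_continuous z)).abs.tendsto z).mono_left nhdsWithin_le_nhds
    have hr : Tendsto (fun a => 2 * (b - a)) (𝓝[>] z) (𝓝 (2 * (b - z))) := by
      refine Tendsto.mono_left ?_ nhdsWithin_le_nhds
      exact (continuous_const.mul (continuous_const.sub continuous_id)).tendsto z
    rcases hb.eq_or_lt with rfl | hb
    · simp
    · refine le_of_tendsto_of_tendsto hl hr ?_
      filter_upwards [Ioo_mem_nhdsGT hb] with a ha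
      exact key ha.2 (Or.inl ha.1)
  rcases hab.eq_or_lt with rfl | hab
  · simp
  by_cases h1 : b ≤ z
  · exact key hab (Or.inr h1)
  by_cases h2 : z < a
  · exact key hab (Or.inl h2)
  have h3 := hgt (not_le.1 h1).le
  rcases (not_lt.1 h2).eq_or_lt with h | h
  · rwa [h]
  · have h4 := key h (Or.inr le_rfl)
    have := abs_sub_le (steinSol z b) (steinSol z z) (steinSol z a)
    linarith

theorem mul_steinSol_lipschitz {z a b : ℝ} (hab : a ≤ b) :
    |b * steinSol z b - a * steinSol z a| ≤ (2 * |a| + steinBound) * (b - a) := by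
  have h1 : b * steinSol z b - a * steinSol z a =
      a * (steinSol z b - steinSol z a) + (b - a) * steinSol z b := by ring
  rw [h1]
  refine (abs_add_le _ _).trans ?_
  rw [abs_mul, abs_mul, abs_of_nonneg (sub_nonneg.2 hab)]
  have h2 := mul_le_mul_of_nonneg_left (steinSol_lipschitz (z := z) hab) (abs_nonneg a)
  have h3 := mul_le_mul_of_nonneg_left (abs_steinSol_le z b) (sub_nonneg.2 hab)
  linarith

/-- A difference quotient may be replaced by the derivative that Stein's equation prescribes at `a`.
The error is of second order unless the jump is crossed; then the Lipschitz bound and the bound on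
the derivative cost `2 + 2`. -/
theorem steinSol_step {z a b : ℝ} (hab : a < b) :
    |steinSol z b - steinSol z a -
        (b - a) * (a * steinSol z a + (if a ≤ z then 1 else 0) - normalCDF z)| ≤
      (b - a) * ((2 * |a| + steinBound) * (b - a) + 4 * if a ≤ z ∧ z < b then 1 else 0) := by
  have hd := sub_pos.2 hab
  have hB := one_le_steinBound
  by_cases h : a ≤ z ∧ z < b
  · have h1 := steinSol_lipschitz (z := z) hab.le
    have h2 := abs_mul_steinSol_le z a
    have h3 := abs_ite_sub_normalCDF_le (a ≤ z) z
    rw [if_pos h, add_sub_assoc]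
    refine (abs_sub _ _).trans ?_
    rw [abs_mul, abs_of_pos hd]
    have h4 := abs_add_le (a * steinSol z a) ((if a ≤ z then 1 else 0) - normalCDF z)
    have h5 : (b - a) * |a * steinSol z a + ((if a ≤ z then 1 else 0) - normalCDF z)| ≤
        (b - a) * 2 := mul_le_mul_of_nonneg_left (by linarith) hd.le
    have h6 : 0 ≤ (b - a) * ((2 * |a| + steinBound) * (b - a)) := by
      have := abs_nonneg a
      positivity
    linarith
  · obtain ⟨c, hc, he⟩ := steinSol_mean_value (z := z) hab (by
      rw [not_and_or, not_le, not_lt] at h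
      exact h)
    have h1 := mul_steinSol_lipschitz (z := z) hc.1.le
    rw [he, if_neg h, ← mul_sub, abs_mul, abs_of_pos hd, mul_zero, add_zero]
    refine mul_le_mul_of_nonneg_left ?_ hd.le
    have h2 : c * steinSol z c + (if a ≤ z then 1 else 0) - normalCDF z -
        (a * steinSol z a + (if a ≤ z then 1 else 0) - normalCDF z) =
        c * steinSol z c - a * steinSol z a := by ring
    rw [h2]
    refine h1.trans (mul_le_mul_of_nonneg_left (by linarith [hc.2]) ?_)
    have := abs_nonneg a
    linarith

/-! ### Normal approximation of the binomial distribution -/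

/-- The Berry–Esseen theorem for binomial distributions. -/
theorem berryEsseen_binomial {n : ℕ} {p : ℝ} (h0 : 0 < p) (h1 : p < 1)
    (hs1 : 1 ≤ binSD (n + 1) p) (z : ℝ) :
    |binE (n + 1) p (fun k => if (k : ℝ) ≤ (n + 1) * p + binSD (n + 1) p * z then 1 else 0) -
      normalCDF z| ≤ (13 + 2 * steinBound) / binSD (n + 1) p := by
  set s := binSD (n + 1) p with hs_def
  have hs : 0 < s := by linarith
  have hs2 : s ^ 2 = (n + 1) * p * (1 - p) := by simpa using binSD_sq (n + 1) h0.le h1.le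
  have hB := one_le_steinBound
  set μ : ℝ := (n + 1) * p
  set x : ℕ → ℝ := fun k => (k - μ) / s with hx
  have hxs : ∀ k, x (k + 1) - x k = 1 / s := fun k => by
    simp only [hx]
    push_cast
    ring
  have hlt : ∀ k, x k < x (k + 1) := fun k => by
    have : 0 < 1 / s := by positivity
    linarith [hxs k]
  have hxz : ∀ k : ℕ, (k : ℝ) ≤ μ + s * z ↔ x k ≤ z := fun k => by
    rw [hx, div_le_iff₀ hs]
    constructor <;> intro h <;> linarith
  set I : ℕ → ℝ := fun k => if x k ≤ z then 1 else 0 with hI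
  set J : ℕ → ℝ := fun k => if x k ≤ z ∧ z < x (k + 1) then 1 else 0 with hJ
  have hgoal : (fun k : ℕ => if (k : ℝ) ≤ μ + s * z then (1 : ℝ) else 0) = I := by
    funext k
    simp only [hI, hxz]
  rw [hgoal]
  have hEJ : binE n p J ≤ 1 / s := by
    have := binE_interval_le (n := n) h0 h1 (μ + s * z)
    refine le_of_eq_of_le (congrArg _ (funext fun k => ?_)) this
    have h2 := hxz (k + 1)
    push_cast at h2
    simp only [hJ, ← not_le, ← h2, hxz]
  -- Stein's identity lowers the number of trials by one, so the moment bound for `n + 1` trials has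
  -- to be carried over to `n`.
  have hEabs : binE n p (fun k => |x k|) ≤ 2 := by
    have h2 : binE (n + 1) p (fun k => |x k|) ≤ 1 := by
      have h3 := binE_abs_sub_le (n := n) h0 h1
      have h4 : (fun k => |x k|) = fun k : ℕ => 1 / s * |(k : ℝ) - μ| := by
        funext k
        simp only [hx]
        rw [abs_div, abs_of_pos hs]
        ring
      rw [h4, binE_const_mul, one_div_mul_eq_div, div_le_one hs]
      exact h3
    rw [binE_succ] at h2
    have h3 := binE_mono h0.le h1.le (n := n) (g := fun k => |x k| - 1) (h := fun k => |x (k + 1)|)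
      fun k _ => by
        have h4 := abs_sub_abs_le_abs_sub (x k) (x (k + 1))
        have h5 : 0 < 1 / s := by positivity
        rw [abs_sub_comm, hxs, abs_of_pos h5] at h4
        have : 1 / s ≤ 1 := by rw [div_le_one hs]; exact hs1
        linarith
    rw [binE_sub, binE_one] at h3
    nlinarith
  have hErr : binE n p (fun k => (2 * |x k| + steinBound) * (1 / s)) ≤ (4 + steinBound) / s := by
    have : (fun k => (2 * |x k| + steinBound) * (1 / s)) =
        fun k => 1 / s * (2 * |x k| + steinBound) := funext fun k => mul_comm _ _
    rw [this, binE_const_mul, binE_add, binE_const_mul, binE_const, one_div_mul_eq_div]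
    gcongr
    linarith
  set F : ℕ → ℝ := fun k => x k * steinSol z (x k)
  have hstein : binE (n + 1) p F = binE n p fun k => s * (steinSol z (x (k + 1)) - steinSol z (x k)) := by
    have h2 := binE_stein n p (fun k => steinSol z (x k))
    rw [binE_const_mul]
    have h3 : (fun k : ℕ => ((k : ℝ) - μ) * steinSol z (x k)) = fun k => s * F k := by
      funext k
      simp only [F, hx]
      field_simp
    change binE (n + 1) p (fun k : ℕ => ((k : ℝ) - μ) * steinSol z (x k)) = _ at h2
    rw [h3, binE_const_mul, ← hs2] at h2
    refine mul_left_cancel₀ hs.ne' ?_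
    rw [h2]
    ring
  -- Stein's equation is applied under `n` trials; `hC` and `hD` pay for returning to `n + 1`
  -- trials.
  have hA : |binE n p (fun k => s * (steinSol z (x (k + 1)) - steinSol z (x k)) -
      (F k + I k - normalCDF z))| ≤ (4 + steinBound) / s + 4 / s := by
    refine (abs_binE_le h0.le h1.le (h := fun k => (2 * |x k| + steinBound) * (1 / s) + 4 * J k)
      fun k _ => ?_).trans ?_
    · have h2 := steinSol_step (z := z) (hlt k)
      rw [hxs] at h2
      have h3 : s * (steinSol z (x (k + 1)) - steinSol z (x k)) - (F k + I k - normalCDF z) =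
          s * (steinSol z (x (k + 1)) - steinSol z (x k) - 1 / s * (F k + I k - normalCDF z)) := by
        field_simp
      rw [h3, abs_mul, abs_of_pos hs]
      refine (mul_le_mul_of_nonneg_left h2 hs.le).trans (le_of_eq ?_)
      rw [← mul_assoc, mul_one_div_cancel hs.ne', one_mul]
    · rw [binE_add, binE_const_mul]
      have : 4 * binE n p J ≤ 4 / s := by
        rw [← mul_one_div]
        linarith
      linarith
  have hC : |binE n p (fun k => F (k + 1) - F k)| ≤ (4 + steinBound) / s := by
    refine (abs_binE_le h0.le h1.le fun k _ => ?_).trans hErr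
    have := mul_steinSol_lipschitz (z := z) (hlt k).le
    rwa [hxs] at this
  have hD : |binE n p (fun k => I (k + 1) - I k)| ≤ 1 / s := by
    refine (abs_binE_le h0.le h1.le (h := J) fun k _ => ?_).trans hEJ
    have h2 := hlt k
    simp only [hI, hJ]
    by_cases h3 : x k ≤ z <;> by_cases h4 : x (k + 1) ≤ z
    · simp [h3, h4, not_lt.2 h4]
    · simp [h3, h4, not_le.1 h4]
    · exact absurd (h2.le.trans h4) h3
    · simp [h3, h4]
  rw [binE_sub, ← hstein, binE_sub, binE_add, binE_const, binE_succ] at hA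
  rw [binE_sub] at hC hD
  rw [binE_succ]
  have hfin : (13 + 2 * steinBound) / s =
      (4 + steinBound) / s + 4 / s + (4 + steinBound) / s + 1 / s := by ring
  rw [hfin]
  have hp : ∀ {a b c : ℝ}, |a - b| ≤ c → |p * (a - b)| ≤ c := fun {a b c} h => by
    rw [abs_mul, abs_of_pos h0]
    nlinarith [abs_nonneg (a - b)]
  have hC' := abs_le.1 (hp hC)
  have hD' := abs_le.1 (hp hD)
  have hA' := abs_le.1 hA
  rw [abs_le]
  constructor <;> linarith [hC'.1, hC'.2, hD'.1, hD'.2, hA'.1, hA'.2]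

/-! ### The distribution of the weight -/

/-- A Pauli error as a function giving the pair of exponents on each qubit. -/
def qubitEquiv (n : ℕ) : PVec n ≃ (Fin n → ZMod 2 × ZMod 2) :=
  Equiv.ofBijective (fun u i => (u (xPos i), u (xPos i).rev)) <| by
    rw [Fintype.bijective_iff_injective_and_card]
    refine ⟨fun u v h => funext fun j => ?_, ?_⟩
    · by_cases hj : (j : ℕ) < n
      · have := congrArg Prod.fst (congrFun h ⟨j, hj⟩)
        have hx : xPos ⟨j, hj⟩ = j := rfl
        simpa only [hx] using this
      · have hj' : (j.rev : ℕ) < n := by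
          rw [Fin.val_rev]
          omega
        have := congrArg Prod.snd (congrFun h ⟨j.rev, hj'⟩)
        have hx : (xPos ⟨j.rev, hj'⟩).rev = j := Fin.rev_rev j
        simpa only [hx] using this
    · simp [pow_mul, ZMod.card]

theorem weight_eq_card_support {n : ℕ} (u : PVec n) :
    weight u = #{i | qubitEquiv n u i ≠ 0} := by
  unfold weight
  congr 1
  ext i
  simp [qubitEquiv, Prod.ext_iff]

theorem card_filter_support {n : ℕ} (s : Finset (Fin n)) :
    #{f : Fin n → ZMod 2 × ZMod 2 | ({i | f i ≠ 0} : Finset (Fin n)) = s} = 3 ^ #s := by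
  have h : ({f : Fin n → ZMod 2 × ZMod 2 | ({i | f i ≠ 0} : Finset (Fin n)) = s} : Finset _) =
      Fintype.piFinset fun i => if i ∈ s then univ.erase 0 else {0} := by
    ext f
    simp only [mem_filter, mem_univ, true_and, Fintype.mem_piFinset, Finset.ext_iff]
    refine forall_congr' fun i => ?_
    by_cases hi : i ∈ s <;> simp [hi]
  rw [h, Fintype.card_piFinset]
  have h3 : ∀ i, #(if i ∈ s then univ.erase (0 : ZMod 2 × ZMod 2) else {0}) =
      if i ∈ s then 3 else 1 := fun i => by
    split_ifs
    · decide
    · rfl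
  simp only [h3]
  rw [prod_ite_mem, univ_inter, prod_const]

/-- Group the errors by support: each qubit of the support has three nonzero values. -/
theorem sum_weight {n : ℕ} (F : ℕ → ℝ) :
    ∑ u : PVec n, F (weight u) = ∑ w ∈ range (n + 1), (n.choose w : ℝ) * 3 ^ w * F w := by
  have h1 : ∑ u : PVec n, F (weight u) =
      ∑ f : Fin n → ZMod 2 × ZMod 2, F (#{i | f i ≠ 0}) := by
    rw [← (qubitEquiv n).sum_comp]
    exact sum_congr rfl fun u _ => by rw [weight_eq_card_support]
  rw [h1, ← sum_fiberwise univ (fun f : Fin n → ZMod 2 × ZMod 2 =>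
    ({i | f i ≠ 0} : Finset (Fin n)))]
  have h2 : ∀ s : Finset (Fin n), ∑ f : Fin n → ZMod 2 × ZMod 2 with
      ({i | f i ≠ 0} : Finset (Fin n)) = s, F (#{i | f i ≠ 0}) = 3 ^ #s * F #s := fun s => by
    rw [sum_congr rfl (g := fun _ => F #s) fun f hf => by rw [(mem_filter.1 hf).2], sum_const,
      card_filter_support, nsmul_eq_mul]
    push_cast
    rfl
  rw [sum_congr rfl fun s _ => h2 s, ← powerset_univ,
    sum_powerset_apply_card (fun w => (3 : ℝ) ^ w * F w), card_univ, Fintype.card_fin]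
  exact sum_congr rfl fun w _ => by rw [nsmul_eq_mul, mul_assoc]

theorem weight_le {n : ℕ} (u : PVec n) : weight u ≤ n :=
  (card_le_univ _).trans_eq (Fintype.card_fin n)

/-- The probability of each error of weight `w`. -/
def weightProb (n : ℕ) (δ : ℝ) (w : ℕ) : ℝ := (δ / 3) ^ w * (1 - δ) ^ (n - w)

theorem depolarizingLaw_eq_weightProb (n : ℕ) (δ : ℝ) (u : PVec n) :
    depolarizingLaw n δ u = weightProb n δ (weight u) := depolarizingLaw_eq n δ u

theorem choose_mul_weightProb (n : ℕ) (δ : ℝ) (w : ℕ) :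
    (n.choose w : ℝ) * 3 ^ w * weightProb n δ w = (n.choose w : ℝ) * δ ^ w * (1 - δ) ^ (n - w) := by
  have : (3 : ℝ) ^ w ≠ 0 := by positivity
  rw [weightProb, div_pow]
  field_simp

theorem sum_depolarizingLaw_mul (n : ℕ) (δ : ℝ) (g : ℕ → ℝ) :
    ∑ u : PVec n, depolarizingLaw n δ u * g (weight u) = binE n δ g := by
  simp only [depolarizingLaw_eq_weightProb]
  rw [sum_weight (fun w => weightProb n δ w * g w), binE]
  refine sum_congr rfl fun w _ => ?_
  rw [← mul_assoc, choose_mul_weightProb]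

theorem depolarizingLaw_nonneg {n : ℕ} {δ : ℝ} (h0 : 0 ≤ δ) (h1 : δ ≤ 1) (u : PVec n) :
    0 ≤ depolarizingLaw n δ u := by
  have : 0 ≤ 1 - δ := by linarith
  rw [depolarizingLaw_eq]
  positivity

theorem sum_depolarizingLaw (n : ℕ) (δ : ℝ) : ∑ u : PVec n, depolarizingLaw n δ u = 1 := by
  simpa [binE_one] using sum_depolarizingLaw_mul n δ (fun _ => 1)

end PauliGuess

/-! ### The symplectic group and random coding -/

namespace PauliGuess

open Matrix

theorem zmod_two_eq (x : ZMod 2) : x = 0 ∨ x = 1 := by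
  revert x
  decide

theorem revDiag_mulVec {N : ℕ} (x : Fin N → ZMod 2) (i : Fin N) :
    (revDiag N *ᵥ x) i = x i.rev := by
  simp [revDiag, mulVec, dotProduct]

theorem revDiag_transpose (N : ℕ) : (revDiag N)ᵀ = revDiag N := by
  ext i j
  have h : i = j.rev ↔ j = i.rev :=
    ⟨fun h => by rw [h, Fin.rev_rev], fun h => by rw [h, Fin.rev_rev]⟩
  simp [revDiag, h]

theorem revDiag_mul_self (N : ℕ) : revDiag N * revDiag N = 1 := by
  refine Matrix.ext_of_mulVec_single fun j => ?_
  ext i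
  rw [← mulVec_mulVec, revDiag_mulVec, revDiag_mulVec, Fin.rev_rev, one_mulVec]

/-- The symplectic form whose Gram matrix is the reverse diagonal matrix. -/
def sympForm {N : ℕ} (x y : Fin N → ZMod 2) : ZMod 2 := (revDiag N *ᵥ x) ⬝ᵥ y

theorem sympForm_comm {N : ℕ} (x y : Fin N → ZMod 2) : sympForm x y = sympForm y x := by
  rw [sympForm, sympForm, dotProduct_comm, dotProduct_mulVec, ← mulVec_transpose,
    revDiag_transpose]

/-- Index reversal pairs equal terms, which cancel in characteristic two; it has no fixed point
because the dimension is even. -/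
theorem sympForm_self {n : ℕ} (x : PVec n) : sympForm x x = 0 := by
  have h2 : ∀ a b : ZMod 2, a * b + b * a = 0 := by decide
  simp only [sympForm, dotProduct, revDiag_mulVec]
  refine sum_involution (fun i _ => i.rev) (fun i _ => by rw [Fin.rev_rev]; exact h2 _ _)
    (fun i _ _ h => ?_) (fun i _ => mem_univ _) fun i _ => Fin.rev_rev i
  have := congrArg Fin.val h
  rw [Fin.val_rev] at this
  omega

theorem exists_sympForm_eq_one {n : ℕ} {u : PVec n} (hu : u ≠ 0) : ∃ w, sympForm u w = 1 := by
  obtain ⟨i, hi⟩ := Function.ne_iff.1 hu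
  refine ⟨Pi.single i.rev 1, ?_⟩
  rw [sympForm, dotProduct_single, mul_one, revDiag_mulVec, Fin.rev_rev]
  exact (zmod_two_eq (u i)).resolve_left hi

/-- The symplectic transvection `x ↦ x + ⟨a, x⟩ a`. -/
def transvec {N : ℕ} (a : Fin N → ZMod 2) : Matrix (Fin N) (Fin N) (ZMod 2) :=
  1 + vecMulVec a (revDiag N *ᵥ a)

theorem transvec_mulVec {N : ℕ} (a x : Fin N → ZMod 2) :
    transvec a *ᵥ x = x + sympForm a x • a := by
  rw [transvec, add_mulVec, one_mulVec, vecMulVec_mulVec]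
  ext i
  simp [sympForm]

theorem transvec_mem {n : ℕ} (a : PVec n) : transvec a ∈ symplecticSet n := by
  set R := revDiag (2 * n)
  set b := R *ᵥ a with hb
  have h1 : (transvec a)ᵀ = 1 + vecMulVec b a := by
    rw [transvec, transpose_add, transpose_one, transpose_vecMulVec]
  have h2 : R * transvec a = R + vecMulVec b b := by
    rw [transvec, mul_add, mul_one, mul_vecMulVec]
  have h3 : vecMulVec b a * R = vecMulVec b b := by
    rw [vecMulVec_mul, ← mulVec_transpose, revDiag_transpose]
  have h4 : vecMulVec b a * vecMulVec b b = 0 := by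
    have : a ⬝ᵥ b = 0 := by rw [dotProduct_comm]; exact sympForm_self a
    rw [vecMulVec_mul_vecMulVec, this]
    simp
  have h5 : vecMulVec b b + vecMulVec b b = 0 := by
    ext i j
    exact CharTwo.add_self_eq_zero _
  change (transvec a)ᵀ * R * transvec a = R
  rw [mul_assoc, h2, h1, add_mul, one_mul, mul_add, h3, h4, add_zero, add_assoc, h5, add_zero]

theorem one_mem_symplecticSet (n : ℕ) : 1 ∈ symplecticSet n := by simp [symplecticSet]

theorem mul_mem_symplecticSet {n : ℕ} {C T : Matrix (Fin (2 * n)) (Fin (2 * n)) (ZMod 2)}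
    (hC : C ∈ symplecticSet n) (hT : T ∈ symplecticSet n) : C * T ∈ symplecticSet n := by
  change (C * T)ᵀ * revDiag (2 * n) * (C * T) = revDiag (2 * n)
  rw [transpose_mul]
  calc Tᵀ * Cᵀ * revDiag (2 * n) * (C * T) = Tᵀ * (Cᵀ * revDiag (2 * n) * C) * T := by
        simp only [mul_assoc]
    _ = revDiag (2 * n) := by rw [show _ = _ from hC]; exact hT

theorem exists_leftInverse_of_mem {n : ℕ} {C : Matrix (Fin (2 * n)) (Fin (2 * n)) (ZMod 2)}
    (hC : C ∈ symplecticSet n) : ∃ B, B * C = 1 :=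
  ⟨revDiag (2 * n) * (Cᵀ * revDiag (2 * n)), by
    rw [mul_assoc, show Cᵀ * revDiag (2 * n) * C = _ from hC, revDiag_mul_self]⟩

/-- The symplectic group acts transitively on the nonzero vectors. -/
theorem exists_symplectic_mulVec_eq {n : ℕ} {u v : PVec n} (hu : u ≠ 0) (hv : v ≠ 0) :
    ∃ T ∈ symplecticSet n, T *ᵥ u = v := by
  have key : ∀ {u v : PVec n}, sympForm u v = 1 → ∃ T ∈ symplecticSet n, T *ᵥ u = v := by
    intro u v h
    refine ⟨transvec (v - u), transvec_mem _, ?_⟩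
    have h1 : sympForm (v - u) u = 1 := by
      have := sympForm_self u
      rw [sympForm_comm] at h
      rw [sympForm] at h this ⊢
      rw [mulVec_sub, sub_dotProduct, h, this, sub_zero]
    rw [transvec_mulVec, h1, one_smul, add_sub_cancel]
  have hadd : ∀ x y z : PVec n, sympForm x (y + z) = sympForm x y + sympForm x z :=
    fun x y z => dotProduct_add _ _ _
  -- One transvection suffices when the form is `1`; in general two are composed through a common
  -- `w`.
  have hw : ∃ w, sympForm u w = 1 ∧ sympForm v w = 1 := by
    obtain ⟨a, ha⟩ := exists_sympForm_eq_one hu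
    obtain ⟨b, hb⟩ := exists_sympForm_eq_one hv
    rcases zmod_two_eq (sympForm v a) with h1 | h1
    · rcases zmod_two_eq (sympForm u b) with h2 | h2
      · exact ⟨a + b, by rw [hadd, ha, h2, add_zero], by rw [hadd, hb, h1, zero_add]⟩
      · exact ⟨b, h2, hb⟩
    · exact ⟨a, ha, h1⟩
  obtain ⟨w, h1, h2⟩ := hw
  obtain ⟨S, hS, hS'⟩ := key h1
  obtain ⟨T, hT, hT'⟩ := key (sympForm_comm v w ▸ h2)
  exact ⟨T * S, mul_mem_symplecticSet hT hS, by rw [← mulVec_mulVec, hS', hT']⟩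

open Classical in
/-- The symplectic group as a finite set. -/
def symplecticFinset (n : ℕ) : Finset (Matrix (Fin (2 * n)) (Fin (2 * n)) (ZMod 2)) :=
  {C | C ∈ symplecticSet n}

theorem mem_symplecticFinset {n : ℕ} {C : Matrix (Fin (2 * n)) (Fin (2 * n)) (ZMod 2)} :
    C ∈ symplecticFinset n ↔ C ∈ symplecticSet n := by simp [symplecticFinset]

/-- Left multiplication by a symplectic matrix taking `y` to `z` is injective. -/
theorem card_symplectic_mulVec_le {n : ℕ} (w : PVec n) {y z : PVec n} (hy : y ≠ 0) (hz : z ≠ 0) :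
    #{C ∈ symplecticFinset n | C *ᵥ w = y} ≤ #{C ∈ symplecticFinset n | C *ᵥ w = z} := by
  obtain ⟨T, hT, hTy⟩ := exists_symplectic_mulVec_eq hy hz
  obtain ⟨B, hB⟩ := exists_leftInverse_of_mem hT
  refine card_le_card_of_injOn (fun C => T * C) (fun C hC => ?_) fun C _ C' _ h => ?_
  · simp only [coe_filter, mem_symplecticFinset, Set.mem_ofPred_eq] at hC ⊢
    exact ⟨mul_mem_symplecticSet hT hC.1, by rw [← mulVec_mulVec, hC.2, hTy]⟩
  · have := congrArg (fun M => B * M) (show T * C = T * C' from h)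
    simpa [← mul_assoc, hB] using this

/-- The first `m` coordinates of a vector. -/
def firstCoords {n m : ℕ} (hm : m ≤ n) (z : PVec n) : Fin m → ZMod 2 :=
  fun i => z (Fin.castLE (hm.trans (Nat.le_mul_of_pos_left n two_pos)) i)

/-- Translating the vectors with vanishing first coordinates by the `2 ^ m` lifts of possible
syndromes gives distinct vectors, and a nonzero one is never translated to zero. -/
theorem card_firstCoords_eq_zero_le {n m : ℕ} (hm : m ≤ n) :
    2 ^ m * #{z : PVec n | z ≠ 0 ∧ firstCoords hm z = 0} ≤ #{z : PVec n | z ≠ 0} := by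
  let lift : (Fin m → ZMod 2) → PVec n := fun s j => if h : (j : ℕ) < m then s ⟨j, h⟩ else 0
  have hlift : ∀ s, firstCoords hm (lift s) = s := fun s => by
    ext i
    simp [lift, firstCoords]
  have hadd : ∀ s z, firstCoords hm z = 0 → firstCoords hm (lift s + z) = s := fun s z hz => by
    conv_rhs => rw [← hlift s, ← add_zero (firstCoords hm (lift s)), ← hz]
    rfl
  have hcard : 2 ^ m = #(univ : Finset (Fin m → ZMod 2)) := by simp [ZMod.card]
  rw [hcard, ← card_product]
  refine card_le_card_of_injOn (fun q => lift q.1 + q.2) (fun q hq => ?_) fun q hq q' hq' h => ?_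
  · simp only [coe_product, coe_univ, coe_filter, mem_univ, true_and, Set.mem_prod,
      Set.mem_univ, Set.mem_ofPred_eq] at hq ⊢
    intro h0
    have h1 := hadd q.1 q.2 hq.2
    rw [h0] at h1
    have h2 : lift q.1 = 0 := by
      rw [← h1]
      funext j
      simp only [lift, firstCoords, Pi.zero_apply, dite_eq_ite, ite_self]
    rw [h2, zero_add] at h0
    exact hq.1 h0
  · simp only [coe_product, coe_univ, coe_filter, mem_univ, true_and, Set.mem_prod,
      Set.mem_univ, Set.mem_ofPred_eq] at hq hq' h
    have h1 : q.1 = q'.1 := by rw [← hadd q.1 q.2 hq.2, h, hadd q'.1 q'.2 hq'.2]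
    rw [h1] at h
    exact Prod.ext h1 (add_left_cancel h)

/-- For uniform symplectic `C`, the vector `C w` is uniform on the nonzero vectors, so counting
those with vanishing first coordinates suffices. -/
theorem card_syndrome_eq_zero_le {n m : ℕ} (hm : m ≤ n) {w : PVec n} (hw : w ≠ 0) :
    2 ^ m * #{C ∈ symplecticFinset n | syndrome hm C w = 0} ≤ #(symplecticFinset n) := by
  set c := #{C ∈ symplecticFinset n | C *ᵥ w = w}
  have hc : ∀ z : PVec n, z ≠ 0 → #{C ∈ symplecticFinset n | C *ᵥ w = z} = c := fun z hz =>
    le_antisymm (card_symplectic_mulVec_le w hz hw) (card_symplectic_mulVec_le w hw hz)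
  have hne : ∀ C ∈ symplecticFinset n, C *ᵥ w ≠ 0 := fun C hC h => by
    obtain ⟨B, hB⟩ := exists_leftInverse_of_mem (mem_symplecticFinset.1 hC)
    apply hw
    rw [← one_mulVec w, ← hB, ← mulVec_mulVec, h, mulVec_zero]
  have h1 : #(symplecticFinset n) = #{z : PVec n | z ≠ 0} * c := by
    rw [card_eq_sum_card_fiberwise (f := fun C => C *ᵥ w) (t := ({z | z ≠ 0} : Finset (PVec n)))
      fun C hC => by simpa using hne C hC,
      sum_congr rfl fun z hz => hc z (mem_filter.1 hz).2, sum_const, smul_eq_mul]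
  have h2 : #{C ∈ symplecticFinset n | syndrome hm C w = 0} =
      #{z : PVec n | z ≠ 0 ∧ firstCoords hm z = 0} * c := by
    rw [card_eq_sum_card_fiberwise (f := fun C => C *ᵥ w)
      (t := ({z | z ≠ 0 ∧ firstCoords hm z = 0} : Finset (PVec n)))
      fun C hC => by
        rw [mem_coe, mem_filter] at hC
        rw [mem_coe, mem_filter]
        exact ⟨mem_univ _, hne C hC.1, hC.2⟩]
    refine sum_const_nat fun z hz => ?_
    rw [← hc z (mem_filter.1 hz).2.1, filter_filter]
    congr 1
    refine filter_congr fun C _ => ⟨fun h => h.2, fun h => ⟨?_, h⟩⟩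
    rw [← (mem_filter.1 hz).2.2, ← h]
    rfl
  rw [h1, h2, ← mul_assoc]
  exact Nat.mul_le_mul_right c (card_firstCoords_eq_zero_le hm)

/-- Each wrong guess is witnessed by a competitor of no greater weight with the same syndrome, which
is the form needed for a union bound. On syndromes that never occur the guess is an arbitrary `0`.
-/
theorem exists_min_weight_decoder {n m : ℕ} (hm : m ≤ n)
    (C : Matrix (Fin (2 * n)) (Fin (2 * n)) (ZMod 2)) :
    ∃ D : (Fin m → ZMod 2) → PVec n, ∀ u, D (syndrome hm C u) ≠ u →
      ∃ v, v ≠ u ∧ weight v ≤ weight u ∧ syndrome hm C (v - u) = 0 := by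
  have h : ∀ s : Fin m → ZMod 2, ∃ v : PVec n, ∀ u, syndrome hm C u = s →
      syndrome hm C v = s ∧ weight v ≤ weight u := fun s => by
    by_cases hs : ∃ u, syndrome hm C u = s
    · obtain ⟨u, hu⟩ := hs
      obtain ⟨v, hv, hmin⟩ := exists_min_image {u | syndrome hm C u = s} weight ⟨u, by simpa⟩
      exact ⟨v, fun u hu => ⟨(mem_filter.1 hv).2, hmin u (by simpa)⟩⟩
    · exact ⟨0, fun u hu => absurd ⟨u, hu⟩ hs⟩
  choose D hD using h
  refine ⟨D, fun u hu => ⟨_, hu, (hD _ u rfl).2, ?_⟩⟩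
  have h1 := (hD _ u rfl).1
  funext i
  have h2 := congrFun h1 i
  simp only [syndrome, mulVec_sub, Pi.sub_apply, Pi.zero_apply] at h2 ⊢
  rw [h2, sub_self]

/-- A random coding bound for minimum weight decoding. -/
theorem exists_guessErrorProb_le {n m : ℕ} (hm : m ≤ n) {p : PVec n → ℝ} (hp : ∀ u, 0 ≤ p u)
    (A : PVec n → Prop) [DecidablePred A] :
    ∃ C ∈ symplecticSet n, ∃ D, guessErrorProb hm p C D ≤
      ∑ u, p u * if A u then (#{v : PVec n | weight v ≤ weight u} : ℝ) / 2 ^ m else 1 := by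
  choose D hD using fun C => exists_min_weight_decoder hm (n := n) C
  have hS : (symplecticFinset n).Nonempty := ⟨1, mem_symplecticFinset.2 (one_mem_symplecticSet n)⟩
  have hcard : (0 : ℝ) < #(symplecticFinset n) := by exact_mod_cast hS.card_pos
  -- On `A` the error indicator is bounded by the number of competitors with the same syndrome,
  -- elsewhere by `1`; averaging over `C` then yields one good matrix.
  let b : Matrix (Fin (2 * n)) (Fin (2 * n)) (ZMod 2) → PVec n → ℝ := fun C u =>
    if A u then ∑ v with v ≠ u ∧ weight v ≤ weight u, (if syndrome hm C (v - u) = 0 then 1 else 0)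
    else 1
  have hb : ∀ C, guessErrorProb hm p C (D C) ≤ ∑ u, p u * b C u := fun C => by
    rw [guessErrorProb, sum_filter]
    refine sum_le_sum fun u _ => ?_
    have hnn : ∀ s : Finset (PVec n),
        0 ≤ ∑ v ∈ s, (if syndrome hm C (v - u) = 0 then (1 : ℝ) else 0) := fun s =>
      sum_nonneg fun v _ => by split_ifs <;> norm_num
    split_ifs with h
    · refine le_mul_of_one_le_right (hp u) ?_
      simp only [b]
      split_ifs
      · obtain ⟨v, h1, h2, h3⟩ := hD C u h
        refine le_trans (le_of_eq ?_) (single_le_sum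
          (f := fun v => if syndrome hm C (v - u) = 0 then (1 : ℝ) else 0)
          (fun v _ => by split_ifs <;> norm_num)
          (mem_filter.2 ⟨mem_univ v, h1, h2⟩))
        simp [h3]
      · exact le_rfl
    · refine mul_nonneg (hp u) ?_
      simp only [b]
      split_ifs
      · exact hnn _
      · exact zero_le_one
  have hsum : ∑ C ∈ symplecticFinset n, ∑ u, p u * b C u ≤ ∑ C ∈ symplecticFinset n,
      ∑ u, p u * if A u then (#{v : PVec n | weight v ≤ weight u} : ℝ) / 2 ^ m else 1 := by
    rw [sum_comm, sum_const, nsmul_eq_mul, mul_sum]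
    refine sum_le_sum fun u _ => ?_
    rw [← mul_sum, mul_left_comm]
    refine mul_le_mul_of_nonneg_left ?_ (hp u)
    simp only [b]
    split_ifs
    · rw [sum_comm]
      calc _ ≤ ∑ v : PVec n with v ≠ u ∧ weight v ≤ weight u,
            (#(symplecticFinset n) : ℝ) / 2 ^ m := by
            refine sum_le_sum fun v hv => ?_
            have hvu : v - u ≠ 0 := sub_ne_zero.2 (mem_filter.1 hv).2.1
            rw [sum_boole, le_div_iff₀ (by positivity), mul_comm]
            exact_mod_cast card_syndrome_eq_zero_le hm hvu
        _ ≤ ∑ v : PVec n with weight v ≤ weight u, (#(symplecticFinset n) : ℝ) / 2 ^ m :=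
            sum_le_sum_of_subset_of_nonneg
              (fun v hv => by
                simp only [mem_filter, mem_univ, true_and] at hv ⊢
                exact hv.2)
              fun _ _ _ => by positivity
        _ = _ := by
            rw [sum_const, nsmul_eq_mul]
            ring
    · simp
  obtain ⟨C, hC, hle⟩ := exists_le_of_sum_le hS hsum
  exact ⟨C, mem_symplecticFinset.1 hC, D C, (hb C).trans hle⟩

/-- A converse bound: at most `2 ^ m` errors are guessed correctly. -/
theorem one_le_guessErrorProb_add {n m : ℕ} (hm : m ≤ n) {p : PVec n → ℝ} (hp : ∀ u, 0 ≤ p u)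
    (hp1 : ∑ u, p u = 1) (A : PVec n → Prop) [DecidablePred A] {B : ℝ} (hB : 0 ≤ B)
    (hAB : ∀ u, ¬ A u → p u ≤ B) (C : Matrix (Fin (2 * n)) (Fin (2 * n)) (ZMod 2))
    (D : (Fin m → ZMod 2) → PVec n) :
    1 ≤ guessErrorProb hm p C D + (∑ u, p u * if A u then 1 else 0) + 2 ^ m * B := by
  have h1 := sum_filter_add_sum_filter_not univ (fun u => D (syndrome hm C u) ≠ u) p
  rw [hp1] at h1
  simp only [not_not] at h1
  have h2 : ∑ u with D (syndrome hm C u) = u, p u ≤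
      ∑ u with D (syndrome hm C u) = u, ((p u * if A u then 1 else 0) + B) := by
    refine sum_le_sum fun u _ => ?_
    split_ifs with h
    · linarith
    · linarith [hAB u h]
  have h3 : ∑ u with D (syndrome hm C u) = u, (p u * if A u then 1 else 0) ≤
      ∑ u, p u * if A u then 1 else 0 :=
    sum_le_sum_of_subset_of_nonneg (filter_subset _ _) fun u _ _ =>
      mul_nonneg (hp u) (by split_ifs <;> norm_num)
  -- Correctly guessed errors are values of the decoder.
  have h4 : #{u : PVec n | D (syndrome hm C u) = u} ≤ 2 ^ m := by
    calc #{u : PVec n | D (syndrome hm C u) = u} ≤ #(univ.image D) := card_le_card fun u hu =>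
          mem_image.2 ⟨_, mem_univ _, (mem_filter.1 hu).2⟩
      _ ≤ #(univ : Finset (Fin m → ZMod 2)) := card_image_le
      _ = 2 ^ m := by simp [ZMod.card]
  have h5 : (#{u : PVec n | D (syndrome hm C u) = u} : ℝ) * B ≤ 2 ^ m * B :=
    mul_le_mul_of_nonneg_right (by exact_mod_cast h4) hB
  rw [sum_add_distrib, sum_const, nsmul_eq_mul] at h2
  rw [guessErrorProb]
  linarith

/-! ### Blocks of equal weight in a sorted list -/

/-- The number of vectors of weight less than `i`. -/
def cumCount (n i : ℕ) : ℕ := ∑ j ∈ range i, n.choose j * 3 ^ j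

theorem card_weight_lt (n i : ℕ) : #{u : PVec n | weight u < i} = cumCount n i := by
  have h := sum_weight (n := n) (fun w => if w < i then 1 else 0)
  rw [sum_boole] at h
  have h2 : (#{u : PVec n | weight u < i} : ℝ) = cumCount n i := by
    rw [h, cumCount]
    push_cast
    simp only [mul_ite, mul_one, mul_zero]
    rw [← sum_filter]
    refine sum_subset (fun w hw => ?_) fun w hw hw' => ?_
    · simpa using (mem_filter.1 hw).2
    · have : n < w := by
        by_contra h
        exact hw' (mem_filter.2 ⟨mem_range.2 (by omega), mem_range.1 hw⟩)
      simp [Nat.choose_eq_zero_of_lt this]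
  exact_mod_cast h2

theorem cumCount_succ (n i : ℕ) : cumCount n (i + 1) = cumCount n i + n.choose i * 3 ^ i :=
  sum_range_succ _ _

theorem cumCount_mono (n : ℕ) : Monotone (cumCount n) :=
  monotone_nat_of_le_succ fun i => by rw [cumCount_succ]; exact Nat.le_add_right _ _

theorem cumCount_self_succ (n : ℕ) : cumCount n (n + 1) = 4 ^ n := by
  rw [cumCount, show (4 : ℕ) = 3 + 1 from rfl, add_pow]
  exact sum_congr rfl fun j _ => by rw [one_pow, mul_one, mul_comm]; rfl

theorem weightProb_antitone {n : ℕ} {δ : ℝ} (h0 : 0 ≤ δ) (h1 : δ ≤ 3 / 4) {i j : ℕ} (hij : i ≤ j)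
    (hj : j ≤ n) : weightProb n δ j ≤ weightProb n δ i := by
  unfold weightProb
  have h2 : δ / 3 ≤ 1 - δ := by linarith
  have h3 : 0 ≤ δ / 3 := by positivity
  rw [← Nat.add_sub_of_le hij, pow_add, mul_assoc, show n - i = (j - i) + (n - j) by omega, pow_add,
    Nat.add_sub_of_le hij]
  have h4 : 0 ≤ 1 - δ := by linarith
  gcongr

/-- In a sorted list, the entries number `cumCount n i, …, cumCount n (i + 1) - 1` (counted from
zero) have the probability of an error of weight `i`. -/
theorem IsSortedOrder.apply_eq {n : ℕ} {δ : ℝ} (h0 : 0 ≤ δ) (h1 : δ ≤ 3 / 4)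
    {o : Fin (2 ^ (2 * n)) ≃ PVec n} (ho : IsSortedOrder (depolarizingLaw n δ) o)
    {j : Fin (2 ^ (2 * n))} {i : ℕ} (hi : i ≤ n) (hj1 : cumCount n i ≤ j)
    (hj2 : (j : ℕ) < cumCount n (i + 1)) :
    depolarizingLaw n δ (o j) = weightProb n δ i := by
  refine le_antisymm ?_ ?_
  -- An entry that is too likely forces the first `j + 1` entries to have weight below `i`; in the
  -- other case all vectors of weight at most `i` would precede entry `j`. Both contradict the
  -- counts, and no strict monotonicity in the weight is needed.
  · by_contra! hlt
    have hsub : (Iic j).map o.toEmbedding ⊆ ({u : PVec n | weight u < i} : Finset _) := fun u hu => by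
      obtain ⟨l, hl, rfl⟩ := mem_map.1 hu
      have h2 := hlt.trans_le (ho (mem_Iic.1 hl))
      simp only [depolarizingLaw_eq_weightProb] at h2
      rw [mem_filter]
      refine ⟨mem_univ _, ?_⟩
      by_contra! h3
      exact h2.not_ge (weightProb_antitone h0 h1 h3 (weight_le _))
    have := card_le_card hsub
    rw [card_map, card_weight_lt, Fin.card_Iic] at this
    omega
  · by_contra! hlt
    have hsub : ({u : PVec n | weight u < i + 1} : Finset _) ⊆ (Iio j).map o.toEmbedding := fun u hu => by
      refine mem_map.2 ⟨o.symm u, mem_Iio.2 ?_, o.apply_symm_apply u⟩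
      by_contra! h2
      have h3 := ho h2
      simp only [o.apply_symm_apply] at h3
      have h4 := h3.trans_lt hlt
      rw [depolarizingLaw_eq_weightProb] at h4
      exact h4.not_ge (weightProb_antitone h0 h1 (Nat.lt_succ_iff.1 (mem_filter.1 hu).2) hi)
    have := card_le_card hsub
    rw [card_map, card_weight_lt, Fin.card_Iio] at this
    omega

/-- Summation over an initial segment of a sorted list. -/
theorem IsSortedOrder.sum_eq {n : ℕ} {δ : ℝ} (h0 : 0 ≤ δ) (h1 : δ ≤ 3 / 4)
    {o : Fin (2 ^ (2 * n)) ≃ PVec n} (ho : IsSortedOrder (depolarizingLaw n δ) o)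
    (G : ℕ → ℝ) (L : ℕ) :
    ∀ M : ℕ, L ≤ n → cumCount n L ≤ M → M ≤ cumCount n (L + 1) →
    ∑ u with position o u ≤ M,
        depolarizingLaw n δ u * (G (position o u) - G (position o u - 1)) =
      ∑ i ∈ range L, weightProb n δ i * (G (cumCount n (i + 1)) - G (cumCount n i)) +
        weightProb n δ L * (G M - G (cumCount n L)) := by
  have hsum : ∀ M ≤ 2 ^ (2 * n), ∑ u with position o u ≤ M + 1,
        depolarizingLaw n δ u * (G (position o u) - G (position o u - 1)) =
      ∑ u with position o u ≤ M,
        depolarizingLaw n δ u * (G (position o u) - G (position o u - 1)) +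
      if h : M < 2 ^ (2 * n) then depolarizingLaw n δ (o ⟨M, h⟩) * (G (M + 1) - G M) else 0 := by
    intro M hM
    split_ifs with h
    · have hu : ∀ u, position o u ≤ M + 1 ↔ (u = o ⟨M, h⟩ ∨ position o u ≤ M) := fun u => by
        rw [← o.symm_apply_eq, Fin.ext_iff]
        simp only [position]
        omega
      have h2 : position o (o ⟨M, h⟩) = M + 1 := by simp [position]
      rw [filter_congr fun u _ => hu u, filter_or, filter_eq', if_pos (mem_univ _),
        sum_union (by simp [h2]), sum_singleton, h2, add_comm, Nat.add_sub_cancel]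
    · rw [add_zero]
      congr 1
      refine filter_congr fun u _ => ?_
      have := (o.symm u).isLt
      simp only [position]
      omega
  have hcard : ∀ i ≤ n + 1, cumCount n i ≤ 2 ^ (2 * n) := fun i hi => by
    refine (cumCount_mono n hi).trans ?_
    rw [cumCount_self_succ, pow_mul]
    norm_num
  -- Within a block the probability is constant, so the increments of `G` telescope.
  have hstep : ∀ L ≤ n, ∀ S : ℝ, ∑ u with position o u ≤ cumCount n L,
        depolarizingLaw n δ u * (G (position o u) - G (position o u - 1)) = S →
      ∀ M, cumCount n L ≤ M → M ≤ cumCount n (L + 1) →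
      ∑ u with position o u ≤ M,
        depolarizingLaw n δ u * (G (position o u) - G (position o u - 1)) =
        S + weightProb n δ L * (G M - G (cumCount n L)) := by
    intro L hL S hS M hM
    induction M, hM using Nat.le_induction with
    | base => intro _; rw [hS]; ring
    | succ M hM ih =>
      intro hM'
      have h2 := hcard (L + 1) (by omega)
      rw [hsum M (by omega), ih (by omega), dif_pos (by omega),
        ho.apply_eq h0 h1 hL (j := ⟨M, by omega⟩) hM hM']
      ring
  induction L with
  | zero =>
    intro M hL hM1 hM2
    refine hstep 0 hL _ ?_ M hM1 hM2
    rw [range_zero, sum_empty]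
    refine sum_eq_zero fun u hu => ?_
    simp [cumCount, position] at hu
  | succ L ih =>
    intro M hL hM1 hM2
    refine hstep (L + 1) hL _ ?_ M hM1 hM2
    rw [ih (cumCount n (L + 1)) (by omega) (cumCount_mono n (Nat.le_succ L)) le_rfl,
      sum_range_succ]

/-! ### The interpolated binomial distribution function and its inverse -/

theorem binCDFInt_natCast (N : ℕ) (p : ℝ) (i : ℕ) :
    binCDFInt N p i = ∑ j ∈ range (i + 1), (N.choose j : ℝ) * p ^ j * (1 - p) ^ (N - j) := by
  rw [binCDFInt]
  rfl

theorem binCDFInt_add_one (N : ℕ) (p : ℝ) (i : ℕ) :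
    binCDFInt N p (i + 1) = binCDFInt N p i +
      (N.choose (i + 1) : ℝ) * p ^ (i + 1) * (1 - p) ^ (N - (i + 1)) := by
  have := binCDFInt_natCast N p (i + 1)
  push_cast at this
  rw [this, sum_range_succ, binCDFInt_natCast]

theorem binCDFInt_neg_one (N : ℕ) (p : ℝ) : binCDFInt N p (-1) = 0 := by simp [binCDFInt]

theorem binCDF_intCast (N : ℕ) (p : ℝ) (i : ℤ) : binCDF N p i = binCDFInt N p i := by
  simp [binCDF]

theorem binCDFInt_self (N : ℕ) (p : ℝ) : binCDFInt N p N = 1 := by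
  rw [binCDFInt_natCast]
  simpa [binE] using binE_one N p

/-- The number of failures is binomial with parameter `1 - p`. -/
theorem binCDFInt_reflect (N : ℕ) (p : ℝ) (i : ℤ) (h1 : -1 ≤ i) (h2 : i ≤ N) :
    binCDFInt N (1 - p) (N - 1 - i) = 1 - binCDFInt N p i := by
  obtain ⟨k, rfl⟩ : ∃ k : ℕ, i = (k : ℤ) - 1 := ⟨(i + 1).toNat, by omega⟩
  have hk : k ≤ N + 1 := by omega
  have ha : ((N : ℤ) - 1 - (k - 1) + 1).toNat = N + 1 - k := by omega
  have hb : ((k : ℤ) - 1 + 1).toNat = k := by omega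
  have h := binE_one N p
  rw [binE] at h
  simp only [mul_one] at h
  rw [← sum_range_add_sum_Ico _ hk, sum_Ico_eq_sum_range] at h
  rw [binCDFInt, binCDFInt, ha, hb, ← eq_sub_of_add_eq' h, ← sum_range_reflect _ (N + 1 - k)]
  refine sum_congr rfl fun j hj => ?_
  have hj := mem_range.1 hj
  have e1 : N + 1 - k - 1 - j = N - (k + j) := by omega
  rw [e1, Nat.choose_symm (by omega), sub_sub_cancel, show N - (N - (k + j)) = k + j by omega]
  ring

theorem binCDF_reflect (N : ℕ) (p x : ℝ) (h1 : -1 ≤ x) (h2 : x ≤ N) :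
    binCDF N (1 - p) (N - 1 - x) = 1 - binCDF N p x := by
  have hf1 : -1 ≤ ⌊x⌋ := Int.le_floor.2 (by exact_mod_cast h1)
  have hf2 : ⌊x⌋ ≤ N := by exact_mod_cast (Int.floor_le x).trans h2
  by_cases hx : Int.fract x = 0
  · obtain ⟨i, rfl⟩ : ∃ i : ℤ, x = i := ⟨⌊x⌋, by
      have := Int.floor_add_fract x
      rw [hx, add_zero] at this
      exact this.symm⟩
    rw [Int.floor_intCast] at hf1 hf2
    have : (N : ℝ) - 1 - i = ((N - 1 - i : ℤ) : ℝ) := by push_cast; ring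
    rw [this, binCDF_intCast, binCDF_intCast, binCDFInt_reflect N p i hf1 hf2]
  · have hpos : 0 < Int.fract x := lt_of_le_of_ne (Int.fract_nonneg x) (Ne.symm hx)
    have hfl : ⌊x⌋ + 1 ≤ N := by
      by_contra! h
      have h3 : ⌊x⌋ = N := by omega
      have h4 := Int.floor_add_fract x
      rw [h3] at h4
      push_cast at h4
      linarith
    have hfloor : ⌊(N : ℝ) - 1 - x⌋ = N - 1 - (⌊x⌋ + 1) := by
      rw [Int.floor_eq_iff]
      push_cast
      have := Int.floor_le x
      have := Int.lt_floor_add_one x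
      have h4 := Int.floor_add_fract x
      constructor <;> linarith
    have hfract : Int.fract ((N : ℝ) - 1 - x) = 1 - Int.fract x := by
      rw [Int.fract, hfloor, Int.fract]
      push_cast
      ring
    have e : (N : ℤ) - 1 - (⌊x⌋ + 1) + 1 = N - 1 - ⌊x⌋ := by ring
    rw [binCDF, hfract, hfloor, e, binCDFInt_reflect N p _ (by omega) hfl,
      binCDFInt_reflect N p _ hf1 hf2, binCDF]
    ring

/-- The weight of a uniform vector is Binomial(n, 3/4). -/
theorem binCDFInt_three_quarters (n i : ℕ) (hi : i ≤ n) :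
    binCDFInt n (3 / 4) i = cumCount n (i + 1) / 4 ^ n := by
  rw [binCDFInt_natCast, cumCount]
  push_cast
  rw [sum_div]
  refine sum_congr rfl fun j hj => ?_
  have hj := mem_range.1 hj
  have h4 : (4 : ℝ) ^ n = 4 ^ j * 4 ^ (n - j) := by
    rw [← pow_add]
    congr 1
    omega
  rw [h4, show (1 : ℝ) - 3 / 4 = 1 / 4 by norm_num, div_pow, div_pow, one_pow]
  field_simp

theorem exists_cumCount_le_lt {n M : ℕ} (h1 : 1 ≤ M) (h2 : M < 4 ^ n) :
    ∃ L, L < n ∧ cumCount n (L + 1) ≤ M ∧ M < cumCount n (L + 2) := by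
  have hex : ∃ i, M < cumCount n (i + 1) := ⟨n, by rwa [cumCount_self_succ]⟩
  classical
  obtain ⟨L, hL⟩ : ∃ L, Nat.find hex = L + 1 := Nat.exists_eq_succ_of_ne_zero fun h => by
    have := Nat.find_spec hex
    rw [h] at this
    simp [cumCount] at this
    omega
  refine ⟨L, ?_, ?_, ?_⟩
  · have := Nat.find_min' hex (m := n) (by rwa [cumCount_self_succ])
    omega
  · have := Nat.find_min hex (m := L) (by omega)
    omega
  · have := Nat.find_spec hex
    rwa [hL] at this

/-- The inverse of the interpolated `Binomial(n, 3/4)` distribution function at `M / 4 ^ n`. -/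
theorem binCDFInv_three_quarters {n M : ℕ} (h1 : 1 ≤ M) (h2 : M < 4 ^ n) {ℓ : ℝ}
    (hℓ : ℓ = binCDFInv n (3 / 4) ((M : ℝ) / 4 ^ n)) :
    ∃ L : ℕ, ⌊ℓ⌋ = L ∧ L < n ∧ cumCount n (L + 1) ≤ M ∧ M ≤ cumCount n (L + 2) ∧
      (M : ℝ) - cumCount n (L + 1) = Int.fract ℓ * (n.choose (L + 1) * 3 ^ (L + 1)) := by
  have h4 : (0 : ℝ) < 4 ^ n := by positivity
  have hval : ∀ (x : ℝ) (L : ℕ), ⌊x⌋ = L → L < n → binCDF n (3 / 4) x =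
      (cumCount n (L + 1) + Int.fract x * (n.choose (L + 1) * 3 ^ (L + 1))) / 4 ^ n := by
    intro x L hx hL
    have e : ((L : ℤ) + 1) = ((L + 1 : ℕ) : ℤ) := by push_cast; rfl
    rw [binCDF, hx, e, binCDFInt_three_quarters n L hL.le, binCDFInt_three_quarters n (L + 1) hL,
      cumCount_succ n (L + 1)]
    push_cast
    field_simp
    ring
  have hex : ∃ x ∈ Set.Icc (-1 : ℝ) n, binCDF n (3 / 4) x = (M : ℝ) / 4 ^ n := by
    obtain ⟨L, hL, hL1, hL2⟩ := exists_cumCount_le_lt h1 h2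
    rw [cumCount_succ n (L + 1)] at hL2
    have hL1' : (cumCount n (L + 1) : ℝ) ≤ M := by exact_mod_cast hL1
    have hL2' : (M : ℝ) < cumCount n (L + 1) + n.choose (L + 1) * 3 ^ (L + 1) := by
      exact_mod_cast hL2
    have hpos : (0 : ℝ) < n.choose (L + 1) * 3 ^ (L + 1) := by linarith
    set c : ℝ := n.choose (L + 1) * 3 ^ (L + 1)
    set t : ℝ := (M - cumCount n (L + 1)) / c with ht
    have ht0 : 0 ≤ t := div_nonneg (by linarith) hpos.le
    have ht1 : t < 1 := by
      rw [ht, div_lt_one hpos]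
      linarith
    have hfl : ⌊(L : ℝ) + t⌋ = L := by
      rw [Int.floor_eq_iff]
      push_cast
      constructor <;> linarith
    have hfr : Int.fract ((L : ℝ) + t) = t := by
      rw [Int.fract, hfl]
      push_cast
      ring
    refine ⟨L + t, ⟨?_, ?_⟩, ?_⟩
    · have : (0 : ℝ) ≤ L := Nat.cast_nonneg L
      linarith
    · have : (L : ℝ) + 1 ≤ n := by exact_mod_cast hL
      linarith
    · rw [hval _ L hfl hL, hfr, ht, div_mul_cancel₀ _ hpos.ne']
      ring
  -- Only the fact that `ℓ` is some preimage in the interval is used; injectivity is not needed.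
  have hmem : ℓ ∈ Set.Icc (-1 : ℝ) n := hℓ ▸ Function.invFunOn_mem hex
  have heq : binCDF n (3 / 4) ℓ = (M : ℝ) / 4 ^ n := hℓ ▸ Function.invFunOn_eq hex
  have hM1 : (1 : ℝ) ≤ M := by exact_mod_cast h1
  have hM2 : (M : ℝ) < 4 ^ n := by exact_mod_cast h2
  have hf1 : -1 ≤ ⌊ℓ⌋ := Int.le_floor.2 (by exact_mod_cast hmem.1)
  -- On `[-1, 0)` the interpolation stays below `1 / 4 ^ n`, while `M ≥ 1`.
  have hne : ⌊ℓ⌋ ≠ -1 := fun h => by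
    have h5 := binCDFInt_three_quarters n 0 n.zero_le
    rw [binCDF, h, binCDFInt_neg_one, show (-1 : ℤ) + 1 = ((0 : ℕ) : ℤ) by rfl, h5] at heq
    have h6 : cumCount n (0 + 1) = 1 := by simp [cumCount]
    rw [h6] at heq
    field_simp at heq
    push_cast at heq
    linarith [Int.fract_lt_one ℓ]
  obtain ⟨L, hL⟩ : ∃ L : ℕ, ⌊ℓ⌋ = L := ⟨⌊ℓ⌋.toNat, by omega⟩
  have hLn : L < n := by
    have h5 : ℓ ≠ n := fun h => by
      have h6 := binCDF_intCast n (3 / 4) n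
      rw [binCDFInt_self, Int.cast_natCast, ← h, heq, div_eq_one_iff_eq h4.ne'] at h6
      linarith
    have h6 : (L : ℝ) ≤ ℓ := by
      have := Int.floor_le ℓ
      rw [hL] at this
      exact_mod_cast this
    exact_mod_cast h6.trans_lt (lt_of_le_of_ne hmem.2 h5)
  have hfin : (M : ℝ) - cumCount n (L + 1) = Int.fract ℓ * (n.choose (L + 1) * 3 ^ (L + 1)) := by
    rw [hval ℓ L hL hLn, div_left_inj' h4.ne'] at heq
    linarith
  have hc : (0 : ℝ) ≤ n.choose (L + 1) * 3 ^ (L + 1) := by positivity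
  refine ⟨L, hL, hLn, ?_, ?_, hfin⟩
  · have : (cumCount n (L + 1) : ℝ) ≤ M := by nlinarith [Int.fract_nonneg ℓ]
    exact_mod_cast this
  · rw [cumCount_succ n (L + 1)]
    have : (M : ℝ) ≤ cumCount n (L + 1) + n.choose (L + 1) * 3 ^ (L + 1) := by
      nlinarith [Int.fract_lt_one ℓ]
    exact_mod_cast this

/-! ### Closed forms of the converse and achievability bounds -/

theorem sum_mul_sub_abel (q A : ℕ → ℝ) (hA : A 0 = 0) (L : ℕ) (B : ℝ) :
    ∑ i ∈ range L, q i * (A (i + 1) - A i) + q L * (B - A L) =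
      q L * B + ∑ i ∈ range L, (q i - q (i + 1)) * A (i + 1) := by
  induction L generalizing B with
  | zero => simp [hA]
  | succ L ih =>
    have := ih (A (L + 1))
    rw [sum_range_succ, sum_range_succ, this]
    ring

/-- The first `2 ^ m` entries are the blocks up to weight `⌊ℓ⌋` and the fraction `Int.fract ℓ` of
the next one, so their probability is `binCDF n δ ℓ`. -/
theorem errorConverse_depolarizingLaw {n : ℕ} {δ : ℝ} (h0 : 0 ≤ δ) (h1 : δ ≤ 3 / 4)
    {o : Fin (2 ^ (2 * n)) ≃ PVec n} (ho : IsSortedOrder (depolarizingLaw n δ) o) {m : ℕ}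
    (hm : 2 ^ m < 4 ^ n) {ℓ : ℝ} (hℓ : ℓ = binCDFInv n (3 / 4) ((2 : ℝ) ^ m / 4 ^ n)) :
    errorConverse (depolarizingLaw n δ) o m = binCDF n (1 - δ) (n - 1 - ℓ) := by
  obtain ⟨L, hfl, hLn, hM1, hM2, hM⟩ := binCDFInv_three_quarters (ℓ := ℓ) (M := 2 ^ m) Nat.one_le_two_pow hm
    (by rw [hℓ]; push_cast; rfl)
  have hs := ho.sum_eq h0 h1 (fun j => (j : ℝ)) (L + 1) (2 ^ m) hLn hM1 hM2
  have hpos : ∀ u, ((position o u : ℕ) : ℝ) - ((position o u - 1 : ℕ) : ℝ) = 1 := fun u => by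
    simp [position]
  simp only [hpos, mul_one] at hs
  have hterm : ∀ i, weightProb n δ i * ((cumCount n (i + 1) : ℝ) - cumCount n i) =
      (n.choose i : ℝ) * δ ^ i * (1 - δ) ^ (n - i) := fun i => by
    rw [cumCount_succ, ← choose_mul_weightProb]
    push_cast
    ring
  simp only [hterm] at hs
  rw [hM, mul_left_comm, mul_comm (weightProb n δ (L + 1)), choose_mul_weightProb] at hs
  have hle := Int.floor_le ℓ
  have hlt := Int.lt_floor_add_one ℓ
  rw [hfl, Int.cast_natCast] at hle hlt
  have hL0 : (0 : ℝ) ≤ L := Nat.cast_nonneg L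
  have hLn' : (L : ℝ) + 1 ≤ n := by exact_mod_cast hLn
  rw [binCDF_reflect n δ ℓ (by linarith) (by linarith), binCDF, hfl, binCDFInt_add_one,
    add_sub_cancel_left, binCDFInt_natCast, ← hs]
  have h := sum_filter_add_sum_filter_not univ (fun u => position o u ≤ 2 ^ m)
    (depolarizingLaw n δ)
  rw [sum_depolarizingLaw] at h
  simp only [not_le] at h
  rw [errorConverse]
  linarith

theorem weightProb_eq_mul_pow {n : ℕ} {δ : ℝ} (h1 : δ ≤ 3 / 4) {i : ℕ} (hi : i ≤ n) :
    weightProb n δ i = (1 - δ) ^ n * (δ / (3 - 3 * δ)) ^ i := by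
  have h : (1 - δ) ≠ 0 := by
    intro h
    linarith
  have h3 : (1 - δ) * (δ / (3 - 3 * δ)) = δ / 3 := by
    rw [show 3 - 3 * δ = 3 * (1 - δ) by ring]
    field_simp
  conv_rhs => rw [← Nat.sub_add_cancel hi, pow_add, mul_assoc, ← mul_pow, h3, mul_comm]
  rfl

theorem errorAchievability_depolarizingLaw {n : ℕ} {δ : ℝ} (h0 : 0 ≤ δ) (h1 : δ ≤ 3 / 4)
    {o : Fin (2 ^ (2 * n)) ≃ PVec n} (ho : IsSortedOrder (depolarizingLaw n δ) o) {m : ℕ}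
    (hm : 2 ^ m < 4 ^ n) {ℓ : ℝ} (hℓ : ℓ = binCDFInv n (3 / 4) ((2 : ℝ) ^ m / 4 ^ n)) :
    errorAchievability (depolarizingLaw n δ) o m =
      (1 + 1 / (2 : ℝ) ^ (m + 1)) * binCDF n (1 - δ) (n - 1 - ℓ)
        - 1 / (2 : ℝ) ^ (m + 1)
        + (2 : ℝ) ^ ((m : ℤ) - 1) * (1 - δ) ^ n * (δ / (3 - 3 * δ)) ^ (⌊ℓ⌋ + 1)
        + (16 - 16 * δ) ^ n / (2 : ℝ) ^ (m + 1) * ((3 - 4 * δ) / (3 - 3 * δ))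
          * ∑ i ∈ range (⌊ℓ⌋₊ + 1), (δ / (3 - 3 * δ)) ^ i * binCDF n (3 / 4) i ^ 2 := by
  have hconv := errorConverse_depolarizingLaw h0 h1 ho hm hℓ
  obtain ⟨L, hfl, hLn, hM1, hM2, -⟩ := binCDFInv_three_quarters (ℓ := ℓ) (M := 2 ^ m) Nat.one_le_two_pow hm
    (by rw [hℓ]; push_cast; rfl)
  have hnat : ⌊ℓ⌋₊ = L := by
    rw [← Int.floor_toNat, hfl]
    rfl
  have h3 : (3 - 3 * δ) ≠ 0 := by
    intro h
    linarith
  set ρ := δ / (3 - 3 * δ) with hρ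
  have hρ1 : (3 - 4 * δ) / (3 - 3 * δ) = 1 - ρ := by
    rw [hρ, eq_sub_iff_add_eq, ← add_div, div_eq_one_iff_eq h3]
    ring
  -- The increments of `j ^ 2` are `2 (j - 1) + 1`: twice the wanted expectation plus the
  -- probability of the first `2 ^ m` entries, which explains the terms with `1 / 2 ^ (m + 1)`.
  have hs := ho.sum_eq h0 h1 (fun j => (j : ℝ) ^ 2) (L + 1) (2 ^ m) hLn hM1 hM2
  rw [sum_mul_sub_abel (weightProb n δ) (fun i => (cumCount n i : ℝ) ^ 2) (by simp [cumCount])] at hs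
  have hpos : ∀ u, ((position o u : ℕ) : ℝ) ^ 2 - ((position o u - 1 : ℕ) : ℝ) ^ 2 =
      2 * ((position o u : ℝ) - 1) + 1 := fun u => by
    simp only [position, Nat.add_sub_cancel]
    push_cast
    ring
  simp only [hpos] at hs
  have hsplit : ∑ u with position o u ≤ 2 ^ m,
      depolarizingLaw n δ u * (2 * ((position o u : ℝ) - 1) + 1) =
      2 * 2 ^ m * (∑ u with position o u ≤ 2 ^ m,
        depolarizingLaw n δ u * (((position o u : ℝ) - 1) / 2 ^ m)) +
      ∑ u with position o u ≤ 2 ^ m, depolarizingLaw n δ u := by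
    rw [mul_sum, ← sum_add_distrib]
    refine sum_congr rfl fun u _ => ?_
    field_simp
  have h := sum_filter_add_sum_filter_not univ (fun u => position o u ≤ 2 ^ m)
    (depolarizingLaw n δ)
  rw [sum_depolarizingLaw] at h
  simp only [not_le] at h
  rw [errorConverse] at hconv
  have hterm : ∑ i ∈ range (L + 1),
      (weightProb n δ i - weightProb n δ (i + 1)) * (cumCount n (i + 1) : ℝ) ^ 2 =
      (16 - 16 * δ) ^ n * (1 - ρ) * ∑ i ∈ range (L + 1), ρ ^ i * binCDF n (3 / 4) i ^ 2 := by
    rw [mul_sum]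
    refine sum_congr rfl fun i hi => ?_
    have hi : i + 1 ≤ n := by
      have := mem_range.1 hi
      omega
    have h4 : (4 : ℝ) ^ n ≠ 0 := by positivity
    have h5 := binCDF_intCast n (3 / 4) i
    rw [Int.cast_natCast] at h5
    have h6 : (16 - 16 * δ) ^ n = (4 : ℝ) ^ n * 4 ^ n * (1 - δ) ^ n := by
      rw [← mul_pow, ← mul_pow]
      ring
    rw [h5, binCDFInt_three_quarters n i (by omega), weightProb_eq_mul_pow h1 hi,
      weightProb_eq_mul_pow h1 (Nat.le_of_succ_le hi), ← hρ, h6]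
    field_simp
    ring
  rw [hterm, hsplit, weightProb_eq_mul_pow h1 (show L + 1 ≤ n from hLn), ← hρ] at hs
  have hz : (2 : ℝ) ^ ((m : ℤ) - 1) = 2 ^ m / 2 := by
    rw [zpow_sub_one₀ two_ne_zero, zpow_natCast]
    rfl
  have hzρ : ρ ^ (⌊ℓ⌋ + 1) = ρ ^ (L + 1) := by
    rw [hfl]
    exact_mod_cast zpow_natCast ρ (L + 1)
  rw [errorAchievability, hconv, hz, hzρ, hρ1, hnat]
  rw [hconv] at h
  have h2 : (2 : ℝ) ^ m ≠ 0 := by positivity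
  rw [eq_sub_of_add_eq h] at hs
  push_cast at hs
  rw [pow_succ (2 : ℝ) m]
  set X := ∑ u with position o u ≤ 2 ^ m, depolarizingLaw n δ u * (((position o u : ℝ) - 1) / 2 ^ m)
  set S := ∑ i ∈ range (L + 1), ρ ^ i * binCDF n (3 / 4) i ^ 2
  generalize (16 - 16 * δ) ^ n = Q at hs ⊢
  field_simp
  linarith

end PauliGuess

/-! ### Binomial quantiles and growth estimates -/

namespace PauliGuess

open Filter Asymptotics

theorem normalPDF_mul_sub_le {x y B : ℝ} (hxy : x ≤ y) (hx : -B ≤ x) (hy : y ≤ B) :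
    normalPDF B * (y - x) ≤ normalCDF y - normalCDF x := by
  rcases hxy.eq_or_lt with rfl | hxy
  · simp
  obtain ⟨c, hc, hc'⟩ := exists_hasDerivAt_eq_slope normalCDF normalPDF hxy
    normalCDF_continuous.continuousOn fun c _ => hasDerivAt_normalCDF c
  have h1 : normalPDF B ≤ normalPDF c :=
    normalPDF_le ((abs_le.2 ⟨by linarith [hc.1], by linarith [hc.2]⟩).trans (le_abs_self B))
  rwa [hc', le_div_iff₀ (sub_pos.2 hxy)] at h1

/-- The quantiles of a binomial distribution, up to a bounded error. -/
theorem exists_binomial_quantile {p : ℝ} (h0 : 0 < p) (h1 : p < 1) (z : ℝ) :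
    ∃ a : ℝ, 0 ≤ a ∧ ∀ n : ℕ, 0 < n → 1 ≤ binSD n p → a ≤ binSD n p →
      binE n p (fun k => if (k : ℝ) ≤ n * p + binSD n p * z - a then 1 else 0) ≤
        normalCDF z - 1 / binSD n p ∧
      normalCDF z + 1 / binSD n p ≤
        binE n p (fun k => if (k : ℝ) ≤ n * p + binSD n p * z + a then 1 else 0) := by
  have hB := one_le_steinBound
  set C := 13 + 2 * steinBound with hC
  have hφ := normalPDF_pos (|z| + 1)
  set φ := normalPDF (|z| + 1) with hφ_def
  have ha : 0 ≤ (C + 1) / φ := div_nonneg (by linarith) hφ.le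
  -- A shift by `a / s ≤ 1` keeps the standardized argument in `[-(|z| + 1), |z| + 1]`, where the
  -- density is at least `φ`. So the normal distribution function moves by at least `(C + 1) / s`:
  -- the Berry–Esseen error and the slack `1 / s`.
  refine ⟨(C + 1) / φ, ha, fun n hn hs hs' => ?_⟩
  obtain ⟨n, rfl⟩ := Nat.exists_eq_succ_of_ne_zero hn.ne'
  simp only [Nat.succ_eq_add_one] at hs hs' ⊢
  set a := (C + 1) / φ with ha_def
  set s := binSD (n + 1) p
  have hs0 : 0 < s := by linarith
  have hle : a / s ≤ 1 := by rwa [div_le_one hs0]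
  have hnn : 0 ≤ a / s := by positivity
  have hid : φ * (a / s) = C / s + 1 / s := by
    rw [ha_def]
    field_simp
  have hz1 := neg_abs_le z
  have hz2 := le_abs_self z
  have hBE := fun z => abs_le.1 (berryEsseen_binomial (n := n) h0 h1 hs z)
  constructor
  · have h2 := (hBE (z - a / s)).2
    have h3 := normalPDF_mul_sub_le (x := z - a / s) (y := z) (B := |z| + 1) (by linarith)
      (by linarith) (by linarith)
    have e : (n + 1 : ℝ) * p + s * (z - a / s) = (n + 1) * p + s * z - a := by
      field_simp
      ring
    rw [e] at h2
    rw [sub_sub_cancel, ← hφ_def, hid] at h3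
    push_cast
    linarith
  · have h2 := (hBE (z + a / s)).1
    have h3 := normalPDF_mul_sub_le (x := z) (y := z + a / s) (B := |z| + 1) (by linarith)
      (by linarith) (by linarith)
    have e : (n + 1 : ℝ) * p + s * (z + a / s) = (n + 1) * p + s * z + a := by
      field_simp
      ring
    rw [e] at h2
    rw [add_sub_cancel_left, ← hφ_def, hid] at h3
    push_cast
    linarith

theorem binSD_eq {p : ℝ} (n : ℕ) :
    binSD n p = Real.sqrt (p * (1 - p)) * Real.sqrt n := by
  rw [binSD, mul_assoc, mul_comm, Real.sqrt_mul' _ (Nat.cast_nonneg n)]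

theorem tendsto_binSD {p : ℝ} (h0 : 0 < p) (h1 : p < 1) :
    Tendsto (fun n : ℕ => binSD n p) atTop atTop := by
  have : 0 < p * (1 - p) := mul_pos h0 (by linarith)
  simp only [binSD_eq]
  exact (Real.tendsto_sqrt_atTop.comp tendsto_natCast_atTop_atTop).const_mul_atTop
    (Real.sqrt_pos.2 this)

theorem eventually_linear_dominates {a : ℝ} (ha : 0 < a) (b c d : ℝ) :
    ∀ᶠ n : ℕ in atTop, 0 ≤ a * n + b * Real.sqrt n + c * Real.logb 2 n + d := by
  have h1 : (fun x : ℝ => Real.sqrt x) =o[atTop] fun x => x := by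
    refine isLittleO_of_tendsto' ?_ ?_
    · filter_upwards [eventually_gt_atTop 0] with x hx h
      exact absurd h hx.ne'
    · simp only [Real.sqrt_div_self]
      exact (tendsto_inv_atTop_zero.comp Real.tendsto_sqrt_atTop).congr fun x => rfl
  have h2 : (fun x : ℝ => Real.logb 2 x) =o[atTop] fun x => x := by
    have := Real.isLittleO_log_id_atTop.const_mul_left (Real.log 2)⁻¹
    simpa [Real.logb, div_eq_inv_mul, Function.id_def] using this
  have h3 : (fun _ : ℝ => d) =o[atTop] fun x => x := isLittleO_const_id_atTop d
  have h := ((h1.const_mul_left b).add (h2.const_mul_left c)).add h3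
  have h4 := tendsto_natCast_atTop_atTop.eventually (h.bound ha)
  filter_upwards [h4] with n hn
  rw [Real.norm_eq_abs, Real.norm_natCast] at hn
  linarith [(abs_le.1 hn).1]

/-! ### Logarithmic probabilities and the number of competitors -/

/-- The decrease of the logarithm of the probability of an error with its weight. -/
def probSlope (δ : ℝ) : ℝ := -Real.logb 2 (δ / (3 * (1 - δ)))

/-- Minus the logarithm of the probability of no error on one qubit. -/
def probBase (δ : ℝ) : ℝ := -Real.logb 2 (1 - δ)

theorem probSlope_nonneg {δ : ℝ} (h0 : 0 < δ) (h1 : δ ≤ 3 / 4) : 0 ≤ probSlope δ := by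
  have h2 : 0 < 3 * (1 - δ) := by linarith
  refine neg_nonneg.2 (Real.logb_nonpos one_lt_two (by positivity) ?_)
  rw [div_le_one h2]
  linarith

theorem probSlope_pos {δ : ℝ} (h0 : 0 < δ) (h1 : δ < 3 / 4) : 0 < probSlope δ := by
  have h2 : 0 < 3 * (1 - δ) := by linarith
  refine neg_pos.2 (Real.logb_neg one_lt_two (by positivity) ?_)
  rw [div_lt_one h2]
  linarith

theorem probBase_pos {δ : ℝ} (h0 : 0 < δ) (h1 : δ < 1) : 0 < probBase δ :=
  neg_pos.2 (Real.logb_neg one_lt_two (by linarith) (by linarith))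

/-- Both sides are the entropy in bits of the error on one qubit. -/
theorem one_sub_hashingBound {δ : ℝ} (h0 : 0 < δ) (h1 : δ < 1) :
    1 - hashingBound δ = δ * probSlope δ + probBase δ := by
  have h2 : 1 - δ ≠ 0 := by linarith
  rw [hashingBound, binEntropyTwo, probSlope, probBase,
    Real.logb_div h0.ne' (mul_ne_zero three_ne_zero h2), Real.logb_mul three_ne_zero h2]
  ring

theorem weightProb_eq_rpow {n : ℕ} {δ : ℝ} (h0 : 0 < δ) (h1 : δ ≤ 3 / 4) {w : ℕ} (hw : w ≤ n) :
    weightProb n δ w = (2 : ℝ) ^ (-(probSlope δ * w + probBase δ * n)) := by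
  have h2 : 0 < 1 - δ := by linarith
  have h3 : 0 < δ / (3 * (1 - δ)) := by positivity
  rw [weightProb_eq_mul_pow h1 hw, show 3 - 3 * δ = 3 * (1 - δ) by ring, probSlope, probBase]
  have e : -(-Real.logb 2 (δ / (3 * (1 - δ))) * w + -Real.logb 2 (1 - δ) * n) =
      Real.logb 2 (1 - δ) * n + Real.logb 2 (δ / (3 * (1 - δ))) * w := by ring
  rw [e, Real.rpow_add two_pos, Real.rpow_mul two_pos.le, Real.rpow_mul two_pos.le,
    Real.rpow_logb two_pos (by norm_num) h2, Real.rpow_logb two_pos (by norm_num) h3,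
    Real.rpow_natCast, Real.rpow_natCast]

theorem binE_le_sum {n : ℕ} {p : ℝ} (hn : 0 < n) (h0 : 0 < p) (h1 : p < 1) {g : ℕ → ℝ}
    (hg : ∀ k, 0 ≤ g k) : binE n p g ≤ (∑ k ∈ range (n + 1), g k) / binSD n p := by
  rw [sum_div]
  refine sum_le_sum fun k _ => ?_
  rw [← one_div_mul_eq_div]
  refine mul_le_mul_of_nonneg_right ?_ (hg k)
  rw [← binE_indicator]
  refine (binE_indicator_le h0 h1 k).trans (one_div_le_one_div_of_le (binSD_pos hn h0 h1) ?_)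
  rw [binSD_eq, binSD_eq]
  refine mul_le_mul_of_nonneg_left (Real.sqrt_le_sqrt ?_) (Real.sqrt_nonneg _)
  push_cast
  linarith

theorem sum_rpow_le {b : ℝ} (hb : 0 < b) (N : ℕ) (t : ℝ) :
    ∑ k ∈ range N, (if (k : ℝ) ≤ t then (2 : ℝ) ^ (b * k) else 0) ≤
      (2 : ℝ) ^ (b * t) / (1 - (2 : ℝ) ^ (-b)) := by
  have hr : (2 : ℝ) ^ (-b) < 1 := Real.rpow_lt_one_of_one_lt_of_neg one_lt_two (by linarith)
  have hpos : 0 < 1 - (2 : ℝ) ^ (-b) := by linarith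
  have hstep : ∀ x : ℝ, (2 : ℝ) ^ (b * (x - 1)) = (2 : ℝ) ^ (b * x) * (2 : ℝ) ^ (-b) := fun x => by
    rw [← Real.rpow_add two_pos]
    congr 1
    ring
  rw [le_div_iff₀ hpos]
  induction N generalizing t with
  | zero => simpa using (Real.rpow_pos_of_pos two_pos _).le
  | succ N ih =>
    rw [sum_range_succ]
    have hx : (0 : ℝ) < (2 : ℝ) ^ (b * t) := Real.rpow_pos_of_pos two_pos _
    by_cases h : (N : ℝ) ≤ t
    · rw [if_pos h]
      have h2 := ih (t - 1)
      have h3 : ∑ k ∈ range N, (if (k : ℝ) ≤ t then (2 : ℝ) ^ (b * k) else 0) ≤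
          ∑ k ∈ range N, (if (k : ℝ) ≤ N - 1 then (2 : ℝ) ^ (b * k) else 0) := by
        refine sum_le_sum fun k hk => ?_
        have hk : (k : ℝ) + 1 ≤ N := by exact_mod_cast mem_range.1 hk
        rw [if_pos (by linarith), if_pos (by linarith)]
      -- Adding the term with exponent `b * N` to the geometric bound at `N - 1` gives exactly the
      -- bound at `N`.
      have h4 := ih ((N : ℝ) - 1)
      rw [hstep] at h4
      have h5 : (2 : ℝ) ^ (b * N) ≤ (2 : ℝ) ^ (b * t) :=
        Real.rpow_le_rpow_of_exponent_le one_le_two (by nlinarith)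
      have h6 := mul_le_mul_of_nonneg_right h3 hpos.le
      nlinarith
    · rw [if_neg h, add_zero]
      exact ih t

/-- Counting is the expectation of the inverse probability. This grows geometrically with the
weight, as `δ < 3/4`, so the last term dominates; the local bound supplies the factor `1 / binSD n
δ`. -/
theorem card_weight_le_le {n : ℕ} {δ : ℝ} (hn : 0 < n) (h0 : 0 < δ) (h1 : δ < 3 / 4) (w : ℕ) :
    (#{v : PVec n | weight v ≤ w} : ℝ) ≤
      (2 : ℝ) ^ (probBase δ * n) / (1 - (2 : ℝ) ^ (-probSlope δ)) / binSD n δ *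
        (2 : ℝ) ^ (probSlope δ * w) := by
  have hs := binSD_pos hn h0 (by linarith)
  have h2 : (#{v : PVec n | weight v ≤ w} : ℝ) = binE n δ fun k =>
      (2 : ℝ) ^ (probBase δ * n) * if (k : ℝ) ≤ w then (2 : ℝ) ^ (probSlope δ * k) else 0 := by
    rw [← sum_depolarizingLaw_mul, ← sum_boole]
    refine sum_congr rfl fun v _ => ?_
    rw [depolarizingLaw_eq_weightProb, weightProb_eq_rpow h0 h1.le (weight_le v)]
    simp only [Nat.cast_le]
    split_ifs
    · rw [← Real.rpow_add two_pos, ← Real.rpow_add two_pos]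
      conv_lhs => rw [← Real.rpow_zero 2]
      congr 1
      ring
    · simp
  rw [h2, binE_const_mul]
  refine (mul_le_mul_of_nonneg_left ((binE_le_sum hn h0 (by linarith) fun k => ?_).trans
    (div_le_div_of_nonneg_right (sum_rpow_le (probSlope_pos h0 h1) _ _) hs.le))
    (Real.rpow_pos_of_pos two_pos _).le).trans (le_of_eq ?_)
  · split_ifs
    · exact (Real.rpow_pos_of_pos two_pos _).le
    · exact le_rfl
  · ring

/-- The expected number of vectors of no greater weight, on the event of weight at most `t`. -/
theorem sum_card_weight_le {n : ℕ} {δ : ℝ} (hn : 0 < n) (h0 : 0 < δ) (h1 : δ < 3 / 4) (t : ℝ) :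
    ∑ u : PVec n, depolarizingLaw n δ u *
        (if (weight u : ℝ) ≤ t then (#{v : PVec n | weight v ≤ weight u} : ℝ) else 0) ≤
      (2 : ℝ) ^ (probSlope δ * t + probBase δ * n) /
        ((1 - (2 : ℝ) ^ (-probSlope δ)) * binSD n δ) ^ 2 := by
  have hs := binSD_pos hn h0 (by linarith)
  have h_slope := probSlope_pos h0 h1
  have hr : 0 < 1 - (2 : ℝ) ^ (-probSlope δ) :=
    sub_pos.2 (Real.rpow_lt_one_of_one_lt_of_neg one_lt_two (by linarith))
  set c := (2 : ℝ) ^ (probBase δ * n) / (1 - (2 : ℝ) ^ (-probSlope δ)) / binSD n δ with hc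
  have hc0 : 0 ≤ c := by
    have := Real.rpow_pos_of_pos two_pos (probBase δ * n)
    positivity
  calc _ ≤ ∑ u : PVec n, depolarizingLaw n δ u *
        (c * if (weight u : ℝ) ≤ t then (2 : ℝ) ^ (probSlope δ * weight u) else 0) := by
        refine sum_le_sum fun u _ => mul_le_mul_of_nonneg_left ?_
          (depolarizingLaw_nonneg h0.le (by linarith) u)
        split_ifs
        · exact card_weight_le_le hn h0 h1 _
        · simp
    _ = c * binE n δ fun k => if (k : ℝ) ≤ t then (2 : ℝ) ^ (probSlope δ * k) else 0 := by
        rw [sum_depolarizingLaw_mul n δ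
          fun k => c * if (k : ℝ) ≤ t then (2 : ℝ) ^ (probSlope δ * k) else 0, binE_const_mul]
    -- Second use of the geometric sum and of the local bound; hence the square in the result.
    _ ≤ c * ((2 : ℝ) ^ (probSlope δ * t) / (1 - (2 : ℝ) ^ (-probSlope δ)) / binSD n δ) := by
        refine mul_le_mul_of_nonneg_left ((binE_le_sum hn h0 (by linarith) fun k => ?_).trans
          (div_le_div_of_nonneg_right (sum_rpow_le h_slope _ _) hs.le)) hc0
        split_ifs
        · exact (Real.rpow_pos_of_pos two_pos _).le
        · exact le_rfl
    _ = _ := by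
        rw [hc, Real.rpow_add two_pos]
        field_simp

/-! ### Necessary and sufficient numbers of syndrome bits -/

theorem mem_guessRates {n m : ℕ} (hm : m ≤ n) {p : PVec n → ℝ} {ε : ℝ}
    {C : Matrix (Fin (2 * n)) (Fin (2 * n)) (ZMod 2)} (hC : C ∈ symplecticSet n)
    {D : (Fin m → ZMod 2) → PVec n} (h : guessErrorProb hm p C D ≤ ε) :
    ((n : ℝ) - m) / n ∈ guessRates p ε :=
  ⟨m, n - m, Nat.add_sub_of_le hm, by rw [Nat.cast_sub hm], C, hC, D, h⟩

theorem exists_isErrorGuessRate {n : ℕ} {p : PVec n → ℝ} {ε : ℝ} (h : (guessRates p ε).Nonempty) :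
    ∃ R, IsErrorGuessRate p ε R := by
  refine IsCompact.exists_isGreatest (Set.Finite.isCompact ?_) h
  refine ((range (n + 1)).image fun k : ℕ => (k : ℝ) / n).finite_toSet.subset ?_
  rintro r ⟨m, k, hmk, rfl, -⟩
  exact mem_coe.2 (mem_image.2 ⟨k, mem_range.2 (by omega), rfl⟩)

/-- The number of syndrome bits that is needed, up to a bounded error, when `z` is the standard
normal quantile of the success probability. -/
def syndromeBits (δ z : ℝ) (n : ℕ) : ℝ :=
  probSlope δ * (n * δ + binSD n δ * z) + probBase δ * n - Real.logb 2 n / 2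

theorem logb_binSD {δ : ℝ} (h0 : 0 < δ) (h1 : δ < 1) {n : ℕ} (hn : 0 < n) :
    Real.logb 2 (binSD n δ) = Real.logb 2 (Real.sqrt (δ * (1 - δ))) + Real.logb 2 n / 2 := by
  have h2 : 0 < δ * (1 - δ) := mul_pos h0 (by linarith)
  have hn' : (0 : ℝ) < n := by exact_mod_cast hn
  rw [binSD_eq, Real.logb_mul (Real.sqrt_pos.2 h2).ne' (Real.sqrt_pos.2 hn').ne']
  congr 1
  rw [Real.logb, Real.log_sqrt hn'.le, Real.logb]
  ring

theorem syndromeBits_eventually_ge {δ : ℝ} (h0 : 0 < δ) (h1 : δ ≤ 3 / 4) (z c : ℝ) :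
    ∀ᶠ n : ℕ in atTop, c ≤ syndromeBits δ z n := by
  have hH : 0 < δ * probSlope δ + probBase δ :=
    add_pos_of_nonneg_of_pos (mul_nonneg h0.le (probSlope_nonneg h0 h1))
      (probBase_pos h0 (by linarith))
  filter_upwards [eventually_linear_dominates hH
    (probSlope δ * Real.sqrt (δ * (1 - δ)) * z) (-1 / 2) (-c)] with n hn
  rw [syndromeBits, binSD_eq]
  linarith

/-- At least `syndromeBits - O(1)` syndrome bits are needed. -/
theorem exists_le_of_guessErrorProb_le {δ : ℝ} (h0 : 0 < δ) (h1 : δ ≤ 3 / 4) {ε z : ℝ}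
    (hz : normalCDF z = 1 - ε) :
    ∃ K : ℝ, ∀ᶠ n : ℕ in atTop, ∀ (m : ℕ) (hm : m ≤ n)
      (C : Matrix (Fin (2 * n)) (Fin (2 * n)) (ZMod 2)) (D : (Fin m → ZMod 2) → PVec n),
      guessErrorProb hm (depolarizingLaw n δ) C D ≤ ε → syndromeBits δ z n - K ≤ m := by
  have h1' : δ < 1 := by linarith
  obtain ⟨a, ha, hq⟩ := exists_binomial_quantile h0 h1' z
  have h_slope := probSlope_nonneg h0 h1
  refine ⟨probSlope δ * a + Real.logb 2 (Real.sqrt (δ * (1 - δ))), ?_⟩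
  filter_upwards [(tendsto_binSD h0 h1').eventually_ge_atTop 1,
    (tendsto_binSD h0 h1').eventually_ge_atTop a, eventually_gt_atTop 0] with n hs hsa hn m hm C D h
  have hs0 : 0 < binSD n δ := by linarith
  obtain ⟨hF, -⟩ := hq n hn hs hsa
  set t := n * δ + binSD n δ * z - a with ht
  set B := (2 : ℝ) ^ (-(probSlope δ * t + probBase δ * n)) with hB
  have hB0 : 0 < B := Real.rpow_pos_of_pos two_pos _
  have hconv := one_le_guessErrorProb_add hm
    (depolarizingLaw_nonneg h0.le h1'.le) (sum_depolarizingLaw n δ)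
    (fun u => (weight u : ℝ) ≤ t) hB0.le (fun u hu => by
      rw [depolarizingLaw_eq_weightProb, weightProb_eq_rpow h0 h1 (weight_le u), hB]
      refine Real.rpow_le_rpow_of_exponent_le one_le_two ?_
      have := mul_le_mul_of_nonneg_left (not_le.1 hu).le h_slope
      linarith) C D
  rw [sum_depolarizingLaw_mul n δ fun k => if (k : ℝ) ≤ t then 1 else 0] at hconv
  -- Weights up to `t` have total probability at most `1 - ε - 1 / binSD n δ`, so correct guesses
  -- beyond `t` must make up the difference.
  have h2 : 1 / binSD n δ ≤ 2 ^ m * B := by linarith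
  have h3 := Real.logb_le_logb_of_le one_lt_two (by positivity) h2
  rw [one_div, Real.logb_inv, Real.logb_mul (by positivity) hB0.ne', hB,
    Real.logb_rpow two_pos (by norm_num), Real.logb_pow, Real.logb_self_eq_one one_lt_two,
    logb_binSD h0 h1' hn] at h3
  rw [syndromeBits]
  have h4 : probSlope δ * t = probSlope δ * (n * δ + binSD n δ * z) - probSlope δ * a := by
    rw [ht]
    ring
  linarith

/-- `syndromeBits + O(1)` syndrome bits suffice. -/
theorem exists_guessErrorProb_le_of_le {δ : ℝ} (h0 : 0 < δ) (h1 : δ < 3 / 4) {ε z : ℝ}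
    (hz : normalCDF z = 1 - ε) :
    ∃ K : ℝ, ∀ᶠ n : ℕ in atTop, ∀ (m : ℕ) (hm : m ≤ n), syndromeBits δ z n + K ≤ m →
      ∃ C ∈ symplecticSet n, ∃ D, guessErrorProb hm (depolarizingLaw n δ) C D ≤ ε := by
  have h1' : δ < 1 := by linarith
  obtain ⟨a, ha, hq⟩ := exists_binomial_quantile h0 h1' z
  have h_slope := probSlope_pos h0 h1
  have hr : 0 < 1 - (2 : ℝ) ^ (-probSlope δ) :=
    sub_pos.2 (Real.rpow_lt_one_of_one_lt_of_neg one_lt_two (by linarith))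
  set c := 1 - (2 : ℝ) ^ (-probSlope δ)
  refine ⟨probSlope δ * a - Real.logb 2 (Real.sqrt (δ * (1 - δ))) - 2 * Real.logb 2 c, ?_⟩
  filter_upwards [(tendsto_binSD h0 h1').eventually_ge_atTop 1,
    (tendsto_binSD h0 h1').eventually_ge_atTop a, eventually_gt_atTop 0] with n hs hsa hn m hm h
  have hs0 : 0 < binSD n δ := by linarith
  obtain ⟨-, hF⟩ := hq n hn hs hsa
  set t := n * δ + binSD n δ * z + a with ht
  obtain ⟨C, hC, D, hD⟩ := exists_guessErrorProb_le hm
    (depolarizingLaw_nonneg (n := n) h0.le h1'.le) (fun u => (weight u : ℝ) ≤ t)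
  refine ⟨C, hC, D, hD.trans ?_⟩
  have hsplit : ∀ u : PVec n, (depolarizingLaw n δ u *
      if (weight u : ℝ) ≤ t then (#{v : PVec n | weight v ≤ weight u} : ℝ) / 2 ^ m else 1) =
      (depolarizingLaw n δ u *
        if (weight u : ℝ) ≤ t then (#{v : PVec n | weight v ≤ weight u} : ℝ) else 0) / 2 ^ m +
      (depolarizingLaw n δ u - depolarizingLaw n δ u * if (weight u : ℝ) ≤ t then 1 else 0) :=
    fun u => by split_ifs <;> ring
  rw [sum_congr rfl fun u _ => hsplit u, sum_add_distrib, sum_sub_distrib, ← sum_div,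
    sum_depolarizingLaw, sum_depolarizingLaw_mul n δ fun k => if (k : ℝ) ≤ t then 1 else 0]
  have h2 := div_le_div_of_nonneg_right (sum_card_weight_le hn h0 h1 t)
    (show (0 : ℝ) ≤ 2 ^ m by positivity)
  -- The competitors may use the slack `1 / binSD n δ` left by the quantile; one of the two factors
  -- `binSD n δ` survives and saves `log₂ n / 2` bits.
  have h3 : (2 : ℝ) ^ (probSlope δ * t + probBase δ * n) / (c * binSD n δ) ^ 2 / 2 ^ m ≤
      1 / binSD n δ := by
    have hx : (0 : ℝ) < 2 ^ (probSlope δ * t + probBase δ * n) := Real.rpow_pos_of_pos two_pos _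
    rw [← Real.logb_le_logb one_lt_two (by positivity) (by positivity),
      Real.logb_div (by positivity) (by positivity), Real.logb_div hx.ne' (by positivity),
      one_div, Real.logb_inv, Real.logb_rpow two_pos (by norm_num), Real.logb_pow, Real.logb_pow,
      Real.logb_mul hr.ne' hs0.ne', Real.logb_self_eq_one one_lt_two, logb_binSD h0 h1' hn]
    rw [syndromeBits] at h
    have h4 : probSlope δ * t = probSlope δ * (n * δ + binSD n δ * z) + probSlope δ * a := by
      rw [ht]
      ring
    push_cast
    linarith
  linarith

theorem sub_syndromeBits {δ : ℝ} (h0 : 0 < δ) (h1 : δ < 1) (x : ℝ) {n : ℕ} (hn : 0 < n) :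
    n - syndromeBits δ (-x) n = n * (hashingBound δ
      - Real.sqrt (δ * (1 - δ) / n) * x * Real.logb 2 (δ / (3 * (1 - δ)))
      + Real.logb 2 n / (2 * n)) := by
  have hn' : (0 : ℝ) < n := by exact_mod_cast hn
  have h2 := one_sub_hashingBound h0 h1
  have hsq : Real.sqrt (δ * (1 - δ) / n) = binSD n δ / n := by
    rw [binSD_eq, Real.sqrt_div' _ hn'.le, div_eq_div_iff (Real.sqrt_pos.2 hn').ne' hn'.ne',
      mul_assoc, Real.mul_self_sqrt hn'.le]
  have h3 : Real.logb 2 (δ / (3 * (1 - δ))) = -probSlope δ := by rw [probSlope, neg_neg]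
  rw [hsq, h3, show hashingBound δ = 1 - (δ * probSlope δ + probBase δ) by linarith, syndromeBits]
  field_simp
  ring

/-- An achievable rate bounds the maximum from below. If the random code would need more than `n`
bits, the claimed bound is negative, and rates are nonnegative. -/
theorem exists_rate_lower_bound {δ : ℝ} (h0 : 0 < δ) (h1 : δ ≤ 3 / 4) {ε z : ℝ}
    (hz : normalCDF z = 1 - ε) :
    ∃ K : ℝ, ∀ᶠ n : ℕ in atTop,
      (0 < hashingBound δ → ∃ R, IsErrorGuessRate (depolarizingLaw n δ) ε R) ∧
      ∀ R, IsErrorGuessRate (depolarizingLaw n δ) ε R → n - syndromeBits δ z n - K ≤ n * R := by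
  have h1' : δ < 1 := by linarith
  have hH := one_sub_hashingBound h0 h1'
  have hnonneg : ∀ {n : ℕ} {R : ℝ}, IsErrorGuessRate (depolarizingLaw n δ) ε R → 0 ≤ n * R := by
    rintro n R ⟨⟨m, k, -, rfl, -⟩, -⟩
    positivity
  rcases h1.eq_or_lt with rfl | h1
  -- At `δ = 3/4` all errors are equally likely and the geometric series is lost, but the hashing
  -- bound is `-1`, and `n - syndromeBits = -n + log₂ n / 2` is eventually nonpositive.
  · have hslope : probSlope (3 / 4) = 0 := by norm_num [probSlope]
    have hbase : probBase (3 / 4) = 2 := by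
      rw [probBase, show (1 : ℝ) - 3 / 4 = (2 ^ 2)⁻¹ by norm_num, Real.logb_inv, neg_neg,
        Real.logb_pow, Real.logb_self_eq_one one_lt_two]
      norm_num
    rw [hslope, hbase] at hH
    refine ⟨0, ?_⟩
    filter_upwards [eventually_linear_dominates one_pos 0 (-1 / 2) 0] with n hn
    refine ⟨fun h => by linarith, fun R hR => le_trans ?_ (hnonneg hR)⟩
    rw [syndromeBits, hslope, hbase]
    linarith
  · obtain ⟨K, hK⟩ := exists_guessErrorProb_le_of_le h0 h1 hz
    -- The additional `1` pays for rounding the number of bits up to an integer.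
    refine ⟨K + 1, ?_⟩
    have hach : ∀ᶠ n : ℕ in atTop, syndromeBits δ z n + K ≤ n →
        ∃ r ∈ guessRates (depolarizingLaw n δ) ε, n - syndromeBits δ z n - (K + 1) ≤ n * r := by
      filter_upwards [hK, syndromeBits_eventually_ge h0 h1.le z (-K), eventually_gt_atTop 0]
        with n hn hpos hn0 hle
      have hm : ⌈syndromeBits δ z n + K⌉₊ ≤ n := Nat.ceil_le.2 hle
      obtain ⟨C, hC, D, hD⟩ := hn _ hm (Nat.le_ceil _)
      refine ⟨_, mem_guessRates hm hC hD, ?_⟩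
      have hn' : (n : ℝ) ≠ 0 := by exact_mod_cast hn0.ne'
      rw [mul_div_cancel₀ _ hn']
      linarith [Nat.ceil_lt_add_one (show 0 ≤ syndromeBits δ z n + K by linarith)]
    have hdef : 0 < hashingBound δ → ∀ᶠ n : ℕ in atTop, syndromeBits δ z n + K ≤ n := fun h => by
      filter_upwards [eventually_linear_dominates h
        (-(probSlope δ * Real.sqrt (δ * (1 - δ)) * z)) (1 / 2) (-K)] with n hn
      rw [show hashingBound δ = 1 - (δ * probSlope δ + probBase δ) by linarith] at hn
      rw [syndromeBits, binSD_eq]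
      linarith
    have hdef' : ∀ᶠ n : ℕ in atTop, 0 < hashingBound δ → syndromeBits δ z n + K ≤ n := by
      by_cases h : 0 < hashingBound δ
      · filter_upwards [hdef h] with n hn _ using hn
      · exact Eventually.of_forall fun n h' => absurd h' h
    filter_upwards [hach, hdef'] with n hn hdef
    refine ⟨fun h => ?_, fun R hR => ?_⟩
    · obtain ⟨r, hr, -⟩ := hn (hdef h)
      exact exists_isErrorGuessRate ⟨r, hr⟩
    · by_cases hle : syndromeBits δ z n + K ≤ n
      · obtain ⟨r, hr, hr'⟩ := hn hle
        exact hr'.trans (mul_le_mul_of_nonneg_left (hR.2 hr) (Nat.cast_nonneg n))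
      · linarith [hnonneg hR, not_le.1 hle]

theorem exists_rate_upper_bound {δ : ℝ} (h0 : 0 < δ) (h1 : δ ≤ 3 / 4) {ε z : ℝ}
    (hz : normalCDF z = 1 - ε) :
    ∃ K : ℝ, ∀ᶠ n : ℕ in atTop, ∀ R, IsErrorGuessRate (depolarizingLaw n δ) ε R →
      n * R ≤ n - syndromeBits δ z n + K := by
  obtain ⟨K, hK⟩ := exists_le_of_guessErrorProb_le h0 h1 hz
  refine ⟨K, ?_⟩
  filter_upwards [hK, eventually_gt_atTop 0] with n hn hn0
  rintro R ⟨⟨m, k, hmk, rfl, C, -, D, hD⟩, -⟩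
  have h2 := hn m _ C D hD
  have h3 : (m : ℝ) + k = n := by exact_mod_cast hmk
  have hn' : (n : ℝ) ≠ 0 := by exact_mod_cast hn0.ne'
  rw [mul_div_cancel₀ _ hn']
  linarith

end PauliGuess

namespace PauliGuess

open Filter in
theorem exists_rate_expansion {δ : ℝ} (h0 : 0 < δ) (h1 : δ ≤ 3 / 4) {ε : ℝ} (hε0 : 0 < ε)
    (hε1 : ε < 1) : ∃ (K : ℝ) (N : ℕ), ∀ n : ℕ, N ≤ n →
      (0 < hashingBound δ → ∃ R, IsErrorGuessRate (depolarizingLaw n δ) ε R) ∧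
      ∀ R, IsErrorGuessRate (depolarizingLaw n δ) ε R →
        |R - (hashingBound δ
              - Real.sqrt (δ * (1 - δ) / n) * normalCDFInv ε * Real.logb 2 (δ / (3 * (1 - δ)))
              + Real.logb 2 n / (2 * n))| ≤ K / n := by
  -- The quantile is taken at the success probability, which gives the minus sign of the
  -- second-order term.
  have hz : normalCDF (-normalCDFInv ε) = 1 - ε := by
    rw [normalCDF_neg, normalCDF_normalCDFInv hε0 hε1]
  obtain ⟨K₁, hK₁⟩ := exists_rate_lower_bound h0 h1 hz
  obtain ⟨K₂, hK₂⟩ := exists_rate_upper_bound h0 h1 hz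
  refine ⟨max K₁ K₂, eventually_atTop.1 ?_⟩
  filter_upwards [hK₁, hK₂, eventually_gt_atTop 0] with n hn₁ hn₂ hn
  refine ⟨hn₁.1, fun R hR => ?_⟩
  have hn' : (0 : ℝ) < n := by exact_mod_cast hn
  have h2 := hn₁.2 R hR
  have h3 := hn₂ R hR
  rw [sub_syndromeBits h0 (by linarith) _ hn] at h2 h3
  rw [le_div_iff₀ hn', ← abs_of_pos hn', ← abs_mul, abs_of_pos hn', abs_le, sub_mul, mul_comm R,
    mul_comm _ (n : ℝ)]
  constructor <;> linarith [le_max_left K₁ K₂, le_max_right K₁ K₂]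

end PauliGuess

end

theorem mainTheorem4 (δ : ℝ) (hδ0 : 0 ≤ δ) (hδ1 : δ ≤ 3 / 4) :
    (∀ n m k : ℕ, 0 < n → m + k = n →
      ∀ o : Fin (2 ^ (2 * n)) ≃ PauliGuess.PVec n,
        PauliGuess.IsSortedOrder (PauliGuess.depolarizingLaw n δ) o →
        ∀ ℓ : ℝ, ℓ = PauliGuess.binCDFInv n (3 / 4) ((2 : ℝ) ^ m / 4 ^ n) →
          PauliGuess.errorConverse (PauliGuess.depolarizingLaw n δ) o m
              = PauliGuess.binCDF n (1 - δ) (n - 1 - ℓ) ∧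
          PauliGuess.errorAchievability (PauliGuess.depolarizingLaw n δ) o m
              = (1 + 1 / (2 : ℝ) ^ (m + 1)) * PauliGuess.binCDF n (1 - δ) (n - 1 - ℓ)
                - 1 / (2 : ℝ) ^ (m + 1)
                + (2 : ℝ) ^ ((m : ℤ) - 1) * (1 - δ) ^ n * (δ / (3 - 3 * δ)) ^ (⌊ℓ⌋ + 1)
                + (16 - 16 * δ) ^ n / (2 : ℝ) ^ (m + 1) * ((3 - 4 * δ) / (3 - 3 * δ))
                  * ∑ i ∈ Finset.range (⌊ℓ⌋₊ + 1),
                      (δ / (3 - 3 * δ)) ^ i * PauliGuess.binCDF n (3 / 4) i ^ 2) ∧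
    (0 < δ → ∀ ε : ℝ, 0 < ε → ε < 1 →
      ∃ (K : ℝ) (N : ℕ), ∀ n : ℕ, N ≤ n →
        (0 < PauliGuess.hashingBound δ →
          ∃ R, PauliGuess.IsErrorGuessRate (PauliGuess.depolarizingLaw n δ) ε R) ∧
        ∀ R, PauliGuess.IsErrorGuessRate (PauliGuess.depolarizingLaw n δ) ε R →
          |R - (PauliGuess.hashingBound δ
                - Real.sqrt (δ * (1 - δ) / n) * PauliGuess.normalCDFInv ε
                  * Real.logb 2 (δ / (3 * (1 - δ)))
                + Real.logb 2 n / (2 * n))| ≤ K / n) := by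
  refine ⟨fun n m k hn hmk o ho ℓ hℓ => ?_, fun hδ ε hε0 hε1 =>
    PauliGuess.exists_rate_expansion hδ hδ1 hε0 hε1⟩
  -- Strict since `m ≤ n < 2 * n`; this keeps `ℓ` below `n`.
  have hm : 2 ^ m < 4 ^ n := by
    rw [show (4 : ℕ) = 2 ^ 2 from rfl, ← pow_mul]
    exact Nat.pow_lt_pow_right (by norm_num) (by omega)
  exact ⟨PauliGuess.errorConverse_depolarizingLaw hδ0 hδ1 ho hm hℓ,
    PauliGuess.errorAchievability_depolarizingLaw hδ0 hδ1 ho hm hℓ⟩
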